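/- A tournament is a finite vertex set in which, for every two distinct vertices $v,w$, exactly one of the edges $(v,w)$, $(w,v)$ is present; it is transitive if it contains no directed cycle. A tournament is $H$-free if none of its induced subtournaments is isomorphic to $H$. We write $|H|$ for the number of vertices of $H$ and $\log$ for the natural logarithm. The Erdős–Hajnal coefficient $\epsilon(H)\in[0,\infty]$ of a tournament $H$ is the supremum of all $\epsilon>0$ such that, for every $n$, every $n$-vertex $H$-free tournament contains a transitive subtournament with at least $n^{\epsilon}$ vertices ($\epsilon(H)=0$ if there is no such $\epsilon$). A set $S\subseteq V(H)$ is homogeneous if for every vertex $v\notin S$ either all edges between $v$ and $S$ are directed towards $v$ or all of them are directed away from $v$. $H$ is prime if it has no homogeneous set $S$ with $|S|>1$ and $S\neq V(H)$. Given an ordering $\theta$ of $V(H)$, the graph of backward edges $B(H,\theta)$ is the undirected graph on $V(H)$ in which $v$ and $w$, with $w$ before $v$, are joined if and only if $(v,w)$ is an edge of $H$. The ordering $\theta$ is a star ordering if every connected component of $B(H,\theta)$ is either a single vertex or a star $K_{1,t}$ with $t\ge 1$ whose center comes before all of its leaves or after all of its leaves. (If $t=1$, either of the two vertices may be chosen as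 the center, and the other one is then the leaf.) $H$ is a galaxy if it has a star ordering in which, for a suitable choice of the centers of the components with two vertices, no center of a star lies between two leaves of another star. **Theorem.** There is a universal constant $C>0$ such that every prime galaxy $H$ with $|H|\ge 2$ satisfies $$\epsilon(H)\ \ge\ \frac{C}{|H|^{5}\log |H|}.$$ Moreover, for every $n$, every $n$-vertex $H$-free tournament contains a transitive subtournament with at least $n^{C/(|H|^{5}\log|H|)}$ vertices. -/

import Mathlib

open scoped ENNReal

universe u v

/-- A tournament on the vertex type `V`: for every pair of distinct vertices exactly one of the
edges `(a, b)`, `(b, a)` is present, and there are no loops. -/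
structure Tournament (V : Type u) where
  /-- `Adj a b` means that `(a, b)` is an edge. -/
  Adj : V → V → Prop
  loopless : ∀ a, ¬ Adj a a
  exactly_one : ∀ a b, a ≠ b → Xor (Adj a b) (Adj b a)

namespace Tournament

/-- The subtournament induced by a set of vertices. -/
def induce {V : Type u} (T : Tournament V) (S : Set V) : Tournament S where
  Adj a b := T.Adj a b
  loopless a := T.loopless a
  exactly_one a b h := T.exactly_one a b fun h' => h (Subtype.ext h')

/-- A tournament is transitive if it contains no directed cycle, that is, if no vertex can be
reached from itself along a directed walk with at least one edge. -/
def IsTransitive {V : Type u} (T : Tournament V) : Prop :=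
  ∀ a, ¬ Relation.TransGen T.Adj a a

/-- `T` is `H`-free: no induced subtournament of `T` is isomorphic to `H`. -/
def IsFree {W : Type v} {V : Type u} (T : Tournament W) (H : Tournament V) : Prop :=
  IsEmpty (H.Adj ↪r T.Adj)

/-- Every vertex outside `S` is adjacent from all of `S` or adjacent to all of `S`. -/
def IsHomogeneous {V : Type u} (H : Tournament V) (S : Set V) : Prop :=
  ∀ x, x ∉ S → (∀ w ∈ S, H.Adj w x) ∨ (∀ w ∈ S, H.Adj x w)

/-- A tournament is prime if it has no homogeneous set with more than one vertex other than the
set of all vertices. -/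
def IsPrime {V : Type u} (H : Tournament V) : Prop :=
  ∀ S : Set V, H.IsHomogeneous S → S.Nontrivial → S = Set.univ

/-- `H` satisfies the Erdős–Hajnal conjecture with the exponent `ε > 0`: every `n`-vertex `H`-free
tournament contains a transitive subtournament with at least `n ^ ε` vertices. -/
def SatisfiesEHWith {V : Type u} (H : Tournament V) (ε : ℝ) : Prop :=
  0 < ε ∧ ∀ (n : ℕ) (T : Tournament (Fin n)), T.IsFree H →
    ∃ S : Finset (Fin n), (T.induce (S : Set (Fin n))).IsTransitive ∧ (n : ℝ) ^ ε ≤ (S.card : ℝ)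

/-- The Erdős–Hajnal coefficient: the supremum of all exponents `ε > 0` with which `H` satisfies
the Erdős–Hajnal conjecture. It is extended-valued since every exponent is admissible if `H` has
at most two vertices. -/
noncomputable def ehCoefficient {V : Type u} (H : Tournament V) : ℝ≥0∞ :=
  ⨆ (ε : ℝ) (_ : H.SatisfiesEHWith ε), ENNReal.ofReal ε

section Orderings

variable {V : Type u} [Fintype V]

/-- The graph of backward edges of `H` under the ordering `θ` of its vertices. -/
def backwardGraph (H : Tournament V) (θ : V ≃ Fin (Fintype.card V)) : SimpleGraph V where
  Adj a b := (H.Adj a b ∧ θ b < θ a) ∨ (H.Adj b a ∧ θ a < θ b)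
  symm := ⟨fun _ _ h => h.symm⟩
  loopless := ⟨fun a h => h.elim (fun h => H.loopless a h.1) (fun h => H.loopless a h.1)⟩

/-- The graph of backward edges induces on `S` a star (with at least one leaf) whose center is
`c`. -/
def IsStarWithCenter (H : Tournament V) (θ : V ≃ Fin (Fintype.card V)) (S : Set V) (c : V) :
    Prop :=
  S.Nontrivial ∧ ∃ hc : c ∈ S, (H.backwardGraph θ).induce S = SimpleGraph.starGraph ⟨c, hc⟩

/-- A left star: the center comes before all leaves. -/
def IsLeftStar (H : Tournament V) (θ : V ≃ Fin (Fintype.card V)) (S : Set V) (c : V) : Prop :=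
  H.IsStarWithCenter θ S c ∧ ∀ l ∈ S, l ≠ c → θ c < θ l

/-- A right star: the center comes after all leaves. -/
def IsRightStar (H : Tournament V) (θ : V ≃ Fin (Fintype.card V)) (S : Set V) (c : V) : Prop :=
  H.IsStarWithCenter θ S c ∧ ∀ l ∈ S, l ≠ c → θ l < θ c

/-- A star of the graph of backward edges: a left star or a right star. -/
def IsStar (H : Tournament V) (θ : V ≃ Fin (Fintype.card V)) (S : Set V) (c : V) : Prop :=
  H.IsLeftStar θ S c ∨ H.IsRightStar θ S c

/-- A star ordering: every connected component of the graph of backward edges is a star or a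
singleton. -/
def IsStarOrdering (H : Tournament V) (θ : V ≃ Fin (Fintype.card V)) : Prop :=
  ∀ K : (H.backwardGraph θ).ConnectedComponent,
    (∃ a, K.supp = {a}) ∨ ∃ c, H.IsStar θ K.supp c

/-- `b` is between `a` and `d` in the ordering `θ`. -/
def IsBetween (θ : V ≃ Fin (Fintype.card V)) (b a d : V) : Prop :=
  (θ a < θ b ∧ θ b < θ d) ∨ (θ d < θ b ∧ θ b < θ a)

/-- A galaxy ordering: a star ordering in which no center of a star is between two leaves of another
star. The center of a star with one leaf may be chosen to be any of its two vertices; `center`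
records these choices, and its values at components that are singletons play no role. -/
def IsGalaxyOrdering (H : Tournament V) (θ : V ≃ Fin (Fintype.card V)) : Prop :=
  H.IsStarOrdering θ ∧ ∃ center : (H.backwardGraph θ).ConnectedComponent → V,
    (∀ K, K.supp.Nontrivial → H.IsStar θ K.supp (center K)) ∧
    ∀ K L, K ≠ L → K.supp.Nontrivial → L.supp.Nontrivial →
      ∀ x ∈ L.supp, x ≠ center L → ∀ y ∈ L.supp, y ≠ center L → ¬ IsBetween θ (center K) x y

/-- A galaxy is a tournament that has a galaxy ordering. -/
def IsGalaxy (H : Tournament V) : Prop :=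
  ∃ θ : V ≃ Fin (Fintype.card V), H.IsGalaxyOrdering θ

end Orderings

end Tournament

/-! Let h = |H| and let U be an inclusion-minimal vertex set, of size n, all of whose transitive
subsets have fewer than n^ε vertices. If X ⊆ U is complete to or from a nonempty transitive Y ⊆ U,
the transitive subset of X supplied by minimality can be joined to Y, so |X|^ε + |Y| < n^ε. For ε at
most 1 / (64 h log(2B)), dividing n by B hardly changes n^ε. Hence no set of about n / B vertices is
complete to or from a transitive set of about g = n^ε / (16h) vertices, although it contains a
transitive set of size 8hg.

If H does not embed greedily, the obstruction is a pair of large sets with almost all edges in one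
direction (`IsFree.exists_unbalanced_pair`). Iteration gives 2h + 1 sets, alternately large and
transitive, with almost all edges directed forward (`IsFree.exists_smooth_sequence`). Each center of
the galaxy is assigned to a large set, and the vertices between consecutive centers to a common
transitive set. No center lies between two leaves of a star, so the leaves of a star share a
transitive set; cutting it into consecutive slices directs the edges among them correctly. Different
stars need only forward edges, which abound. The backward edges between a center and its leaves
exist because complete pairs are excluded (`exists_hom_of_stars`, `IsGalaxy.not_isFree`). Thus U
contains H. Since B = h^O(h²), an exponent of order 1 / (h³ log h) is admissible. -/

namespace Tournament

section Combinatorics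

open scoped Classical
open Finset

variable {V : Type u} {W : Type v}

/-! ### Transitive vertex sets -/

theorem Adj.asymm {T : Tournament W} {a b : W} (h : T.Adj a b) : ¬ T.Adj b a := fun h' => by
  have hab : a ≠ b := fun e => T.loopless b (e ▸ h)
  rcases T.exactly_one a b hab with h1 | h1
  · exact h1.2 h'
  · exact h1.2 h

theorem adj_or_adj (T : Tournament W) {a b : W} (h : a ≠ b) : T.Adj a b ∨ T.Adj b a :=
  (T.exactly_one a b h).imp And.left And.left

theorem Adj.ne {T : Tournament W} {a b : W} (h : T.Adj a b) : a ≠ b :=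
  fun e => T.loopless b (e ▸ h)

/-- A set of vertices is transitive if adjacency is a transitive relation on it. -/
def TransOn (T : Tournament W) (S : Finset W) : Prop :=
  ∀ a ∈ S, ∀ b ∈ S, ∀ c ∈ S, T.Adj a b → T.Adj b c → T.Adj a c

theorem TransOn.isTransitive {T : Tournament W} {S : Finset W} (h : T.TransOn S) :
    (T.induce (S : Set W)).IsTransitive := by
  have key : ∀ a b : (S : Set W), Relation.TransGen (T.induce (S : Set W)).Adj a b →
      T.Adj a b := by
    intro a b hab
    induction hab with
    | single h1 => exact h1
    | tail _ h2 ih => exact h _ a.2 _ (Subtype.coe_prop _) _ (Subtype.coe_prop _) ih h2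
  exact fun a ha => T.loopless _ (key a a ha)

theorem TransOn.mono {T : Tournament W} {S S' : Finset W} (h : T.TransOn S) (hs : S' ⊆ S) :
    T.TransOn S' :=
  fun a ha b hb c hc => h a (hs ha) b (hs hb) c (hs hc)

theorem TransOn.union {T : Tournament W} {X Y : Finset W} (hX : T.TransOn X) (hY : T.TransOn Y)
    (h : ∀ x ∈ X, ∀ y ∈ Y, T.Adj x y) : T.TransOn (X ∪ Y) := by
  intro a ha b hb c hc hab hbc
  rw [mem_union] at ha hb hc
  rcases ha with ha | ha <;> rcases hb with hb | hb <;> rcases hc with hc | hc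
  · exact hX a ha b hb c hc hab hbc
  · exact h a ha c hc
  · exact absurd hbc (h c hc b hb).asymm
  · exact h a ha c hc
  · exact absurd hab (h b hb a ha).asymm
  · exact absurd hab (h b hb a ha).asymm
  · exact absurd hbc (h c hc b hb).asymm
  · exact hY a ha b hb c hc hab hbc

theorem transOn_singleton (T : Tournament W) (a : W) : T.TransOn {a} := by
  intro x hx y hy z hz hxy
  rw [mem_singleton] at hx hy
  exact absurd (hx.trans hy.symm) hxy.ne

/-- A transitive set has a rank function that counts the vertices before a given one. -/
theorem TransOn.exists_rank {T : Tournament W} {Z : Finset W} (hZ : T.TransOn Z) :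
    ∃ r : W → ℕ, (∀ x ∈ Z, ∀ y ∈ Z, r x < r y → T.Adj x y) ∧
      ∀ i t, i + t ≤ #Z → #{z ∈ Z | i ≤ r z ∧ r z < i + t} = t := by
  let r : W → ℕ := fun z => #{y ∈ Z | T.Adj y z}
  have hr : ∀ x ∈ Z, ∀ y ∈ Z, T.Adj x y → r x < r y := by
    intro x hx y hy hxy
    apply card_lt_card
    refine ⟨fun z hz => ?_, fun hs => ?_⟩
    · rw [mem_filter] at hz ⊢
      exact ⟨hz.1, hZ z hz.1 x hx y hy hz.2 hxy⟩
    · have := hs (mem_filter.2 ⟨hx, hxy⟩)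
      exact T.loopless x (mem_filter.1 this).2
  have hinj : Set.InjOn r Z := by
    intro x hx y hy hxy
    by_contra hne
    rcases T.adj_or_adj hne with h | h
    · exact (hr x hx y hy h).ne hxy
    · exact (hr y hy x hx h).ne hxy.symm
  -- An injective rank with values below `#Z` takes every such value, so an interval of `t` ranks
  -- catches exactly `t` vertices.
  have himg : Z.image r = range #Z := by
    apply eq_of_subset_of_card_le
    · intro n hn
      obtain ⟨z, hz, rfl⟩ := mem_image.1 hn
      refine mem_range.2 (card_lt_card ⟨filter_subset _ _, fun hs => ?_⟩)
      exact T.loopless z (mem_filter.1 (hs hz)).2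
    · rw [card_image_of_injOn hinj, card_range]
  refine ⟨r, fun x hx y hy hxy => ?_, fun i t hit => ?_⟩
  · by_contra hn
    rcases eq_or_ne x y with rfl | hne
    · exact hxy.ne rfl
    · exact (hr y hy x hx ((T.adj_or_adj hne).resolve_left hn)).asymm hxy
  · have h1 : ({z ∈ Z | i ≤ r z ∧ r z < i + t}).image r = Ico i (i + t) := by
      ext n
      simp only [mem_image, mem_filter, mem_Ico]
      constructor
      · rintro ⟨z, hz, rfl⟩
        exact hz.2
      · intro hn
        have : n ∈ Z.image r := himg ▸ mem_range.2 (by omega)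
        obtain ⟨z, hz, rfl⟩ := mem_image.1 this
        exact ⟨z, ⟨hz, hn⟩, rfl⟩
    rw [← card_image_of_injOn (hinj.mono fun z hz => (mem_filter.1 hz).1), h1, Nat.card_Ico]
    omega

/-! ### Greedy embedding and unbalanced pairs -/

/-- Any two distinct vertices span an edge, and its image is an edge in a known direction;
injectivity and reflection of adjacency therefore come for free. -/
theorem not_isFree_of_hom {T : Tournament W} {H : Tournament V} (φ : V → W)
    (h : ∀ u v, H.Adj u v → T.Adj (φ u) (φ v)) : ¬ T.IsFree H := by
  have hinj : Function.Injective φ := by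
    intro u v huv
    by_contra hne
    rcases H.adj_or_adj hne with h1 | h1
    · exact (h _ _ h1).ne huv
    · exact (h _ _ h1).ne huv.symm
  refine fun hf => hf.false ⟨⟨φ, hinj⟩, fun {u v} => ⟨fun h1 => ?_, h u v⟩⟩
  by_contra hn
  have hne : u ≠ v := by
    rintro rfl
    exact T.loopless _ h1
  exact (h _ _ ((H.adj_or_adj hne).resolve_left hn)).asymm h1

/-- The vertex `y` of `T` is related to `x` in the way `w` is related to `v` in `H`. -/
def Compat (T : Tournament W) (H : Tournament V) (v w : V) (x y : W) : Prop :=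
  (H.Adj v w → T.Adj x y) ∧ (H.Adj w v → T.Adj y x)

/-- In an `H`-free tournament, every large set of vertices contains two large subsets such that
the edges between them are directed almost all in the same way, as seen from each vertex of the
first subset. -/
theorem IsFree.exists_unbalanced_pair [Fintype V] {T : Tournament W} {H : Tournament V}
    (hfree : T.IsFree H) {K : ℕ} (hK : 0 < K) {U : Finset W}
    (hU : (2 * K) ^ (Fintype.card V + 1) ≤ #U) :
    ∃ X ⊆ U, ∃ Y ⊆ U, #U ≤ Fintype.card V * (2 * K) ^ Fintype.card V * #X ∧
      #U ≤ Fintype.card V * (2 * K) ^ Fintype.card V * #Y ∧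
      ((∀ x ∈ X, K * #{y ∈ Y | ¬ T.Adj y x} ≤ #Y) ∨
        (∀ x ∈ X, K * #{y ∈ Y | ¬ T.Adj x y} ≤ #Y)) := by
  by_contra hno
  let C : Finset V → (V → W) → V → Finset W := fun D φ v =>
    {a ∈ U | ∀ u ∈ D, T.Compat H u v (φ u) a}
  -- Each embedded vertex may shrink every other candidate set by a factor `2 * K`. The embedding is
  -- stuck only if every candidate for `v` shrinks some other candidate set further.
  have key : ∀ D : Finset V, ∃ φ : V → W, (∀ u ∈ D, ∀ v ∈ D, H.Adj u v → T.Adj (φ u) (φ v)) ∧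
      ∀ v ∉ D, #U ≤ (2 * K) ^ #D * #(C D φ v) := by
    intro D
    induction D using Finset.induction_on with
    | empty =>
      have hpos : 0 < #U := lt_of_lt_of_le (by positivity) hU
      obtain ⟨a, ha⟩ := card_pos.1 hpos
      exact ⟨fun _ => a, by simp, fun v _ => by simp [C]⟩
    | insert v D hv ih =>
      obtain ⟨φ, hφ, hC⟩ := ih
      by_cases hx : ∃ x ∈ C D φ v, ∀ w, w ∉ insert v D →
          #(C D φ w) ≤ 2 * K * #{y ∈ C D φ w | T.Compat H v w x y}
      · obtain ⟨x, hxC, hx⟩ := hx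
        have hne : ∀ u ∈ D, u ≠ v := fun u hu e => hv (e ▸ hu)
        have hxD := (mem_filter.1 hxC).2
        refine ⟨Function.update φ v x, ?_, ?_⟩
        · intro u hu w hw huw
          rcases mem_insert.1 hu with hu' | hu' <;> rcases mem_insert.1 hw with hw' | hw'
          · exact absurd (hu'.trans hw'.symm) huw.ne
          · subst hu'
            rw [Function.update_self, Function.update_of_ne (hne w hw')]
            exact (hxD w hw').2 huw
          · subst hw'
            rw [Function.update_self, Function.update_of_ne (hne u hu')]
            exact (hxD u hu').1 huw
          · rw [Function.update_of_ne (hne w hw'), Function.update_of_ne (hne u hu')]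
            exact hφ u hu' w hw' huw
        · intro w hw
          have hsub : {y ∈ C D φ w | T.Compat H v w x y} ⊆
              C (insert v D) (Function.update φ v x) w := by
            intro y hy
            obtain ⟨hy1, hy2⟩ := mem_filter.1 hy
            obtain ⟨hy3, hy4⟩ := mem_filter.1 hy1
            refine mem_filter.2 ⟨hy3, fun u hu => ?_⟩
            rcases mem_insert.1 hu with hu' | hu'
            · subst hu'
              rwa [Function.update_self]
            · rw [Function.update_of_ne (hne u hu')]
              exact hy4 u hu'
          calc #U ≤ (2 * K) ^ #D * #(C D φ w) := hC w fun h => hw (mem_insert_of_mem h)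
            _ ≤ (2 * K) ^ #D * (2 * K * #{y ∈ C D φ w | T.Compat H v w x y}) :=
                Nat.mul_le_mul_left _ (hx w hw)
            _ ≤ (2 * K) ^ #D * (2 * K * #(C (insert v D) (Function.update φ v x) w)) := by
                gcongr
            _ = _ := by rw [card_insert_of_notMem hv]; ring
      · exfalso
        push Not at hx
        have hDV : #D ≤ Fintype.card V := card_le_univ D
        have : Nonempty V := ⟨v⟩
        choose! f hf1 hf2 using hx
        -- Pigeonhole: one vertex `w` is spoiled by a fraction `1 / |V|` of the candidates for `v`.
        -- These form `X`, and the candidates for `w` form `Y`.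
        obtain ⟨w, hw⟩ : ∃ w, #(C D φ v) ≤ Fintype.card V * #{x ∈ C D φ v | f x = w} := by
          by_contra hcon
          push Not at hcon
          have h1 : #(C D φ v) = ∑ w : V, #{x ∈ C D φ v | f x = w} :=
            card_eq_sum_card_fiberwise (fun _ _ => mem_coe.2 (mem_univ _))
          have h2 : ∑ w : V, Fintype.card V * #{x ∈ C D φ v | f x = w} <
              ∑ _w : V, #(C D φ v) :=
            sum_lt_sum_of_nonempty ⟨v, mem_univ v⟩ fun w _ => hcon w
          rw [← mul_sum, ← h1, sum_const, card_univ, smul_eq_mul] at h2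
          exact h2.ne rfl
        have hCv : #U ≤ (2 * K) ^ Fintype.card V * #(C D φ v) :=
          (hC v hv).trans (Nat.mul_le_mul_right _ (Nat.pow_le_pow_right (by omega) hDV))
        have hUpos : 0 < #U := lt_of_lt_of_le (by positivity) hU
        have hCvpos : 0 < #(C D φ v) := Nat.pos_of_mul_pos_left (hUpos.trans_le hCv)
        have hXpos : 0 < #{x ∈ C D φ v | f x = w} :=
          Nat.pos_of_mul_pos_left (hCvpos.trans_le hw)
        obtain ⟨x0, hx0⟩ := card_pos.1 hXpos
        obtain ⟨hx0, hx0w⟩ := mem_filter.1 hx0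
        have hwD : w ∉ insert v D := hx0w ▸ hf1 x0 hx0
        have hCw : #U ≤ (2 * K) ^ Fintype.card V * #(C D φ w) :=
          (hC w fun h => hwD (mem_insert_of_mem h)).trans
            (Nat.mul_le_mul_right _ (Nat.pow_le_pow_right (by omega) hDV))
        have hCw' : 2 * K ≤ #(C D φ w) := by
          rw [pow_succ] at hU
          exact Nat.le_of_mul_le_mul_left (hU.trans hCw) (by positivity)
        have hVpos : 0 < Fintype.card V := Fintype.card_pos_iff.2 ⟨v⟩
        have hvw : v ≠ w := fun e => hwD (e ▸ mem_insert_self _ _)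
        -- Since `x` may lie in `Y`, it can add one bad vertex. This costs `K`, at most half of
        -- `#Y`; the other half of the bound comes from using `2 * K` above.
        have hcount : ∀ x (p : W → Prop), 2 * K * #{y ∈ C D φ w | p y} < #(C D φ w) →
            K * #{y ∈ C D φ w | p y ∨ y = x} ≤ #(C D φ w) := by
          intro x p hp
          have h1 : #{y ∈ C D φ w | p y ∨ y = x} ≤ #{y ∈ C D φ w | p y} + 1 := by
            rw [filter_or]
            refine (card_union_le _ _).trans (Nat.add_le_add_left ?_ _)
            refine card_le_one.2 fun a ha b hb => ?_
            exact (mem_filter.1 ha).2.trans (mem_filter.1 hb).2.symm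
          nlinarith
        refine hno ⟨{x ∈ C D φ v | f x = w}, (filter_subset _ _).trans (filter_subset _ _), C D φ w,
          filter_subset _ _, ?_, ?_, ?_⟩
        · calc #U ≤ (2 * K) ^ Fintype.card V * #(C D φ v) := hCv
            _ ≤ (2 * K) ^ Fintype.card V * (Fintype.card V * #{x ∈ C D φ v | f x = w}) :=
                Nat.mul_le_mul_left _ hw
            _ = _ := by ring
        · calc #U ≤ 1 * ((2 * K) ^ Fintype.card V * #(C D φ w)) := by rw [one_mul]; exact hCw
            _ ≤ Fintype.card V * ((2 * K) ^ Fintype.card V * #(C D φ w)) :=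
                Nat.mul_le_mul_right _ hVpos
            _ = _ := by ring
        · rcases H.adj_or_adj hvw with h | h
          · left
            intro x hx
            obtain ⟨hx1, hx2⟩ := mem_filter.1 hx
            have h3 := hf2 x hx1
            rw [hx2] at h3
            refine le_trans (Nat.mul_le_mul_left _ (card_le_card ?_)) (hcount x _ h3)
            intro y hy
            obtain ⟨hy1, hy2⟩ := mem_filter.1 hy
            refine mem_filter.2 ⟨hy1, ?_⟩
            by_cases hyx : y = x
            · exact Or.inr hyx
            · exact Or.inl ⟨fun _ => (T.adj_or_adj hyx).resolve_left hy2,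
                fun h' => absurd h' h.asymm⟩
          · right
            intro x hx
            obtain ⟨hx1, hx2⟩ := mem_filter.1 hx
            have h3 := hf2 x hx1
            rw [hx2] at h3
            refine le_trans (Nat.mul_le_mul_left _ (card_le_card ?_)) (hcount x _ h3)
            intro y hy
            obtain ⟨hy1, hy2⟩ := mem_filter.1 hy
            refine mem_filter.2 ⟨hy1, ?_⟩
            by_cases hyx : y = x
            · exact Or.inr hyx
            · exact Or.inl ⟨fun h' => absurd h' h.asymm,
                fun _ => (T.adj_or_adj hyx).resolve_right hy2⟩
  obtain ⟨φ, hφ, -⟩ := key univ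
  exact not_isFree_of_hom φ (fun u v => hφ u (mem_univ _) v (mem_univ _)) hfree

/-! ### Averaging and sequences of sets with forward edges -/

/-- Markov's inequality without denominators: a function of mean at most c / K exceeds c / K' on at
most a fraction K' / K of `s`. -/
theorem mul_card_filter_lt_le {s : Finset W} {f : W → ℕ} {c K K' : ℕ} (hc : 0 < c)
    (h : K * ∑ x ∈ s, f x ≤ #s * c) : K * #{x ∈ s | c < K' * f x} ≤ K' * #s := by
  have h1 : #{x ∈ s | c < K' * f x} * c ≤ K' * ∑ x ∈ s, f x := by
    rw [mul_sum, ← smul_eq_mul]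
    refine (card_nsmul_le_sum _ _ c fun x hx => ((mem_filter.1 hx).2).le).trans ?_
    exact sum_le_sum_of_subset (filter_subset _ _)
  refine Nat.le_of_mul_le_mul_right ?_ hc
  calc K * #{x ∈ s | c < K' * f x} * c = K * (#{x ∈ s | c < K' * f x} * c) := by ring
    _ ≤ K * (K' * ∑ x ∈ s, f x) := Nat.mul_le_mul_left _ h1
    _ = K' * (K * ∑ x ∈ s, f x) := by ring
    _ ≤ K' * (#s * c) := Nat.mul_le_mul_left _ h
    _ = _ := by ring

theorem sum_card_filter_comm (s t : Finset W) (r : W → W → Prop)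
    [∀ x y, Decidable (r x y)] :
    ∑ x ∈ s, #{y ∈ t | r x y} = ∑ y ∈ t, #{x ∈ s | r x y} := by
  simpa [bipartiteAbove, bipartiteBelow] using
    sum_card_bipartiteAbove_eq_sum_card_bipartiteBelow (s := s) (t := t) r

/-- If few pairs in `Z p × Y` satisfy the relation `r p` for each `p`, then at least half of the
elements of `Y` are in relation to few elements of every `Z p`. -/
theorem exists_subset_forall_few {ι : Type*} {I : Finset ι} {Z : ι → Finset W} {Y : Finset W}
    {r : ι → W → W → Prop} [∀ p x y, Decidable (r p x y)] {L K : ℕ} (hL : 0 < L) (hK : 0 < K) (hI : #I ≤ L)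
    (hZ : ∀ p ∈ I, 0 < #(Z p))
    (h : ∀ p ∈ I, 2 * L * K * ∑ x ∈ Z p, #{y ∈ Y | r p x y} ≤ #(Z p) * #Y) :
    ∃ Y' ⊆ Y, #Y ≤ 2 * #Y' ∧ ∀ y ∈ Y', ∀ p ∈ I, K * #{x ∈ Z p | r p x y} ≤ #(Z p) := by
  let P : ι → Finset W := fun p => {y ∈ Y | #(Z p) < K * #{x ∈ Z p | r p x y}}
  -- By Markov each index spoils at most a fraction 1 / (2L) of `Y`, so at most `L` indices spoil at
  -- most half.
  have hP : ∀ p ∈ I, 2 * L * #(P p) ≤ #Y := by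
    intro p hp
    have h1 := h p hp
    rw [sum_card_filter_comm, mul_comm #(Z p)] at h1
    have h2 := mul_card_filter_lt_le (K' := K) (hZ p hp) h1
    refine Nat.le_of_mul_le_mul_left ?_ hK
    calc K * (2 * L * #(P p)) = 2 * L * K * #(P p) := by ring
      _ ≤ _ := h2
  have hsum : L * (2 * #(I.biUnion P)) ≤ L * #Y := by
    calc L * (2 * #(I.biUnion P)) ≤ L * (2 * ∑ p ∈ I, #(P p)) := by
          gcongr
          exact card_biUnion_le
      _ = ∑ p ∈ I, 2 * L * #(P p) := by rw [← mul_sum]; ring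
      _ ≤ ∑ _p ∈ I, #Y := sum_le_sum hP
      _ = #I * #Y := by rw [sum_const, smul_eq_mul]
      _ ≤ _ := Nat.mul_le_mul_right _ hI
  have hle := Nat.le_of_mul_le_mul_left hsum hL
  refine ⟨Y \ I.biUnion P, sdiff_subset, ?_, fun y hy p hp => ?_⟩
  · have := le_card_sdiff (I.biUnion P) Y
    omega
  · obtain ⟨hy1, hy2⟩ := mem_sdiff.1 hy
    by_contra hn
    exact hy2 (mem_biUnion.2 ⟨p, hp, mem_filter.2 ⟨hy1, not_le.1 hn⟩⟩)

/-- An `H`-free tournament contains a sequence of sets such that the edges are mostly directed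
from earlier to later sets. The sets are large at the odd positions and transitive at the even
positions. -/
theorem IsFree.exists_sequence [Fintype V] [Nonempty V] {T : Tournament W} {H : Tournament V}
    (hfree : T.IsFree H) {U₀ : Finset W} {K L N G : ℕ} (hK : 0 < K) (hL : 0 < L)
    (hN : 2 * (L * K) ≤ N) (hG : 0 < G)
    (htrans : ∀ Y ⊆ U₀, N ≤ #Y → ∃ Z ⊆ Y, T.TransOn Z ∧ G ≤ #Z) :
    ∀ m ≤ L, ∀ a : ℕ, ∀ U ⊆ U₀,
      N * (2 * (Fintype.card V * (2 * (2 * L * K)) ^ Fintype.card V)) ^ m ≤ #U →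
      ∃ Z : ℕ → Finset W, (∀ p, a ≤ p → p < a + m → Z p ⊆ U ∧ 0 < #(Z p) ∧
        (Odd p → N ≤ #(Z p)) ∧ (Even p → T.TransOn (Z p) ∧ G ≤ #(Z p))) ∧
        ∀ p q, a ≤ p → p < q → q < a + m →
          K * ∑ x ∈ Z p, #{y ∈ Z q | ¬ T.Adj x y} ≤ #(Z p) * #(Z q) := by
  set R := Fintype.card V * (2 * (2 * L * K)) ^ Fintype.card V with hR
  have hV : 0 < Fintype.card V := Fintype.card_pos
  have hRpos : 0 < R := by positivity
  have hNpos : 0 < N := lt_of_lt_of_le (by positivity) hN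
  have hsel : ∀ (p : ℕ) (Y : Finset W), Y ⊆ U₀ → N ≤ #Y → ∃ Z ⊆ Y, 0 < #Z ∧
      (Odd p → N ≤ #Z) ∧ (Even p → T.TransOn Z ∧ G ≤ #Z) := by
    intro p Y hY hNY
    rcases Nat.even_or_odd p with hp | hp
    · obtain ⟨Z, hZ, hZ1, hZ2⟩ := htrans Y hY hNY
      exact ⟨Z, hZ, by omega, fun h => absurd hp (Nat.not_even_iff_odd.2 h), fun _ => ⟨hZ1, hZ2⟩⟩
    · exact ⟨Y, subset_rfl, by omega, fun _ => hNY, fun h => absurd h (Nat.not_even_iff_odd.2 hp)⟩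
  intro m
  induction m with
  | zero => exact fun _ a U _ _ => ⟨fun _ => ∅, fun p h1 h2 => by omega, fun p q h1 h2 h3 => by omega⟩
  | succ m ih =>
    intro hm a U hU hUN
    have hUbig : (2 * (2 * L * K)) ^ (Fintype.card V + 1) ≤ #U := by
      calc (2 * (2 * L * K)) ^ (Fintype.card V + 1)
          = (2 * (L * K)) * 1 * 2 * (2 * (2 * L * K)) ^ Fintype.card V := by ring
        _ ≤ N * Fintype.card V * 2 * (2 * (2 * L * K)) ^ Fintype.card V := by gcongr; omega
        _ = N * (2 * R) := by rw [hR]; ring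
        _ ≤ N * (2 * R) ^ (m + 1) := by
            gcongr
            exact Nat.le_self_pow (by omega) _
        _ ≤ #U := hUN
    obtain ⟨X, hX, Y, hY, hXc, hYc, hXY⟩ := hfree.exists_unbalanced_pair (by positivity) hUbig
    rw [← hR] at hXc hYc
    -- Of the factor `2 * R` spent per step, `R` pays for the unbalanced pair and 2 for halving `Y`
    -- below.
    have hsize : ∀ S : Finset W, #U ≤ R * #S → 2 * N * (2 * R) ^ m ≤ #S := by
      intro S hS
      refine Nat.le_of_mul_le_mul_left ?_ hRpos
      calc R * (2 * N * (2 * R) ^ m) = N * (2 * R) ^ (m + 1) := by ring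
        _ ≤ _ := hUN.trans hS
    have hXN : N * (2 * R) ^ m ≤ #X := by
      have := hsize X hXc
      nlinarith [Nat.zero_le (N * (2 * R) ^ m)]
    have hYN : 2 * N ≤ #Y := by
      have h1 := hsize Y hYc
      have : 0 < (2 * R) ^ m := by positivity
      nlinarith
    -- The density bound as seen from `X` is lost when `Y` shrinks to a small transitive set.
    -- Averaging turns it round: each vertex of `Y'` has few bad edges to every `Z p`, which passes
    -- to all subsets of `Y'`.
    have hcomb : ∀ (a' : ℕ) (Z : ℕ → Finset W) (r : W → W → Prop)
        [∀ x y, Decidable (r x y)],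
        (∀ x ∈ X, 2 * L * K * #{y ∈ Y | r x y} ≤ #Y) →
        (∀ p, a' ≤ p → p < a' + m → Z p ⊆ X ∧ 0 < #(Z p)) →
        ∃ Y' ⊆ Y, N ≤ #Y' ∧
          ∀ y ∈ Y', ∀ p, a' ≤ p → p < a' + m → K * #{x ∈ Z p | r x y} ≤ #(Z p) := by
      intro a' Z r _ hr hZ
      obtain ⟨Y', hY', hY'c, hY'r⟩ := exists_subset_forall_few (I := Ico a' (a' + m)) (Z := Z)
        (Y := Y) (r := fun _ => r) hL hK (by simp; omega)
        (fun p hp => (hZ p (mem_Ico.1 hp).1 (mem_Ico.1 hp).2).2)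
        (fun p hp => by
          rw [mul_sum, ← smul_eq_mul #(Z p)]
          exact sum_le_card_nsmul _ _ _ fun x hx =>
            hr x ((hZ p (mem_Ico.1 hp).1 (mem_Ico.1 hp).2).1 hx))
      exact ⟨Y', hY', by omega, fun y hy p h1 h2 => hY'r y hy p (mem_Ico.2 ⟨h1, h2⟩)⟩
    -- The recursion continues inside `X`, and `Y` supplies the first or the last set according to
    -- its direction. In the first case the positions in `X` start at `a + 1`, so the induction must
    -- allow any start and its parity.
    rcases hXY with hXY | hXY
    · obtain ⟨Z, hZ, hZe⟩ := ih (by omega) (a + 1) X (hX.trans hU) hXN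
      obtain ⟨Y', hY', hY'N, hY'r⟩ := hcomb (a + 1) Z (fun x y => ¬ T.Adj y x) hXY
        fun p h1 h2 => ⟨(hZ p h1 h2).1, (hZ p h1 h2).2.1⟩
      obtain ⟨S, hS, hS1, hS2, hS3⟩ := hsel a Y' (hY'.trans (hY.trans hU)) hY'N
      refine ⟨Function.update Z a S, fun p h1 h2 => ?_, fun p q h1 h2 h3 => ?_⟩
      · rcases eq_or_ne p a with rfl | hne
        · rw [Function.update_self]
          exact ⟨hS.trans (hY'.trans hY), hS1, hS2, hS3⟩
        · rw [Function.update_of_ne hne]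
          obtain ⟨h4, h5⟩ := hZ p (by omega) (by omega)
          exact ⟨h4.trans hX, h5⟩
      · rcases eq_or_ne p a with rfl | hne
        · rw [Function.update_self, Function.update_of_ne (by omega), mul_sum,
            ← smul_eq_mul #S]
          exact sum_le_card_nsmul _ _ _ fun x hx => hY'r x (hS hx) q (by omega) (by omega)
        · rw [Function.update_of_ne hne, Function.update_of_ne (by omega)]
          exact hZe p q (by omega) h2 (by omega)
    · obtain ⟨Z, hZ, hZe⟩ := ih (by omega) a X (hX.trans hU) hXN
      obtain ⟨Y', hY', hY'N, hY'r⟩ := hcomb a Z (fun x y => ¬ T.Adj x y) hXY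
        fun p h1 h2 => ⟨(hZ p h1 h2).1, (hZ p h1 h2).2.1⟩
      obtain ⟨S, hS, hS1, hS2, hS3⟩ := hsel (a + m) Y' (hY'.trans (hY.trans hU)) hY'N
      refine ⟨Function.update Z (a + m) S, fun p h1 h2 => ?_, fun p q h1 h2 h3 => ?_⟩
      · rcases eq_or_ne p (a + m) with rfl | hne
        · rw [Function.update_self]
          exact ⟨hS.trans (hY'.trans hY), hS1, hS2, hS3⟩
        · rw [Function.update_of_ne hne]
          obtain ⟨h4, h5⟩ := hZ p (by omega) (by omega)
          exact ⟨h4.trans hX, h5⟩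
      · rcases eq_or_ne q (a + m) with rfl | hne
        · rw [Function.update_self, Function.update_of_ne (by omega), sum_card_filter_comm, mul_sum,
            mul_comm #(Z p), ← smul_eq_mul #S]
          exact sum_le_card_nsmul _ _ _ fun y hy => hY'r y (hS hy) p (by omega) (by omega)
        · rw [Function.update_of_ne hne, Function.update_of_ne (by omega)]
          exact hZe p q (by omega) h2 (by omega)

/-- The pair `x`, `y` is not directed in the way the pair of positions `p`, `q` is. -/
def Backward {ι : Type*} [LT ι] (T : Tournament W) (p q : ι) (x y : W) : Prop :=
  (p < q ∧ ¬ T.Adj x y) ∨ (q < p ∧ ¬ T.Adj y x)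

/-- The sequence of sets can be chosen such that every vertex of a set has few badly directed
edges to every other set. -/
theorem IsFree.exists_smooth_sequence [Fintype V] [Nonempty V] {T : Tournament W}
    {H : Tournament V} (hfree : T.IsFree H) {U₀ : Finset W} {K L N G : ℕ} (hK : 0 < K)
    (hL : 0 < L) (hN : 4 * (L ^ 2 * K) ≤ N) (hG : 0 < G)
    (htrans : ∀ Y ⊆ U₀, N ≤ #Y → ∃ Z ⊆ Y, T.TransOn Z ∧ G ≤ #Z)
    (hU₀ : N * (2 * (Fintype.card V * (8 * L ^ 2 * K) ^ Fintype.card V)) ^ L ≤ #U₀) :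
    ∃ Z : ℕ → Finset W, (∀ p < L, Z p ⊆ U₀ ∧ 0 < #(Z p) ∧
        (Odd p → N ≤ 2 * #(Z p)) ∧ (Even p → T.TransOn (Z p) ∧ G ≤ 2 * #(Z p))) ∧
      ∀ p < L, ∀ q < L, p ≠ q → ∀ x ∈ Z p,
        K * #{y ∈ Z q | T.Backward p q x y} ≤ 2 * #(Z q) := by
  -- The extra factor `2 * L` lets Markov's inequality over all other positions keep half of each
  -- set.
  obtain ⟨Z, hZ, hZe⟩ := hfree.exists_sequence (K := 2 * L * K) (by positivity) hL
    (le_trans (le_of_eq (by ring)) hN) hG htrans L le_rfl 0 U₀ subset_rfl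
    (le_trans (le_of_eq (by ring)) hU₀)
  simp only [zero_le, zero_add, forall_const] at hZ hZe
  have hsm : ∀ p < L, ∃ Z' ⊆ Z p, #(Z p) ≤ 2 * #Z' ∧ ∀ x ∈ Z', ∀ q ∈ (range L).erase p,
      K * #{y ∈ Z q | T.Backward p q x y} ≤ #(Z q) := by
    intro p hp
    refine exists_subset_forall_few (r := fun q y x => T.Backward p q x y) hL hK ?_ ?_ ?_
    · exact (card_erase_le).trans (card_range L).le
    · exact fun q hq => (hZ q (mem_range.1 (mem_of_mem_erase hq))).2.1
    · intro q hq
      obtain ⟨hqp, hq⟩ := mem_erase.1 hq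
      rcases lt_or_gt_of_ne hqp with h | h
      · simpa [Backward, h, h.not_gt] using hZe q p h hp
      · have := hZe p q h (mem_range.1 hq)
        rw [sum_card_filter_comm, mul_comm #(Z p)] at this
        simpa [Backward, h, h.not_gt] using this
  choose! Z' hZ'1 hZ'2 hZ'3 using hsm
  refine ⟨Z', fun p hp => ?_, fun p hp q hq hpq x hx => ?_⟩
  · obtain ⟨h1, h2, h3, h4⟩ := hZ p hp
    have h5 := hZ'2 p hp
    refine ⟨(hZ'1 p hp).trans h1, by omega, fun h => (h3 h).trans h5, fun h => ?_⟩
    exact ⟨(h4 h).1.mono (hZ'1 p hp), (h4 h).2.trans h5⟩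
  -- Bad vertices are counted relative to `Z q`; comparison with its half `Z' q` gives the factor 2.
  · refine le_trans ?_ (hZ'2 q hq)
    refine le_trans ?_ (hZ'3 p hp x hx q (mem_erase.2 ⟨hpq.symm, mem_range.2 hq⟩))
    exact Nat.mul_le_mul_left _ (card_le_card (filter_subset_filter _ (hZ'1 q hq)))

/-! ### Embedding star by star -/

/-- Greedy embedding of a tournament whose graph of backward edges consists of stars into another
tournament, one star at a time. -/
theorem exists_hom_of_stars [Fintype V] {ι : Type*} [LinearOrder ι] {T : Tournament W}
    {H : Tournament V} {G : SimpleGraph V} {θ : V → ι} {ctr : V → Prop}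
    (hθ : Function.Injective θ)
    (hfwd : ∀ u v, θ u < θ v → ¬ G.Adj u v → H.Adj u v)
    (hbwd : ∀ u v, θ u < θ v → G.Adj u v → H.Adj v u)
    (hctr : ∀ u v, ctr u → ctr v → G.connectedComponentMk u = G.connectedComponentMk v → u = v)
    (hleaf : ∀ u v, ¬ ctr u → ¬ ctr v → G.connectedComponentMk u = G.connectedComponentMk v →
      ¬ G.Adj u v)
    (hstar : ∀ u v, ctr u → ¬ ctr v → G.connectedComponentMk u = G.connectedComponentMk v →
      G.Adj u v)
    {S : V → Finset W} (hS : ∀ v, 0 < #(S v))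
    (hsmooth : ∀ u v, G.connectedComponentMk u ≠ G.connectedComponentMk v → ∀ x ∈ S u,
      2 * Fintype.card V * #{y ∈ S v | T.Backward (θ u) (θ v) x y} ≤ #(S v))
    (hsame : ∀ u v, ¬ ctr u → ¬ ctr v → G.connectedComponentMk u = G.connectedComponentMk v →
      θ u < θ v → ∀ x ∈ S u, ∀ y ∈ S v, T.Adj x y)
    (hmix : ∀ c l, ctr c → ¬ ctr l → ∀ X ⊆ S c, ∀ Y ⊆ S l,
      #(S c) ≤ 2 * Fintype.card V * #X → #(S l) ≤ 2 * #Y →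
      ∃ x ∈ X, ∃ y ∈ Y, T.Backward (θ c) (θ l) x y ∧ x ≠ y) :
    ∃ φ : V → W, ∀ u v, H.Adj u v → T.Adj (φ u) (φ v) := by
  have hlt : ∀ u v, H.Adj u v → ¬ G.Adj u v → θ u < θ v := by
    intro u v huv hG
    by_contra hn
    have h1 : θ v < θ u := lt_of_le_of_ne (not_lt.1 hn) fun e => huv.ne (hθ e).symm
    exact huv.asymm (hfwd v u h1 fun h => hG h.symm)
  have hgt : ∀ u v, H.Adj u v → G.Adj u v → θ v < θ u := by
    intro u v huv hG
    by_contra hn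
    have h1 : θ u < θ v := lt_of_le_of_ne (not_lt.1 hn) fun e => huv.ne (hθ e)
    exact huv.asymm (hbwd u v h1 hG)
  have key : ∀ 𝒦 : Finset G.ConnectedComponent, ∃ φ : V → W,
      (∀ v, G.connectedComponentMk v ∈ 𝒦 → φ v ∈ S v) ∧
      ∀ u v, G.connectedComponentMk u ∈ 𝒦 → G.connectedComponentMk v ∈ 𝒦 → H.Adj u v →
        T.Adj (φ u) (φ v) := by
    intro 𝒦
    induction 𝒦 using Finset.induction_on with
    | empty =>
      rcases isEmpty_or_nonempty V with hV | ⟨⟨v⟩⟩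
      · exact ⟨isEmptyElim, fun v => isEmptyElim v, fun v => isEmptyElim v⟩
      · obtain ⟨a, -⟩ := card_pos.1 (hS v)
        exact ⟨fun _ => a, by simp, by simp⟩
    | insert k 𝒦 hk ih =>
      obtain ⟨φ, hφS, hφ⟩ := ih
      let A : V → Finset W := fun v =>
        {a ∈ S v | ∀ u, G.connectedComponentMk u ∈ 𝒦 → ¬ T.Backward (θ u) (θ v) (φ u) a}
      -- Each embedded vertex excludes at most a fraction `1 / (2 |V|)` of `S v`, so half of it
      -- remains.
      have hA : ∀ v, G.connectedComponentMk v = k → #(S v) ≤ 2 * #(A v) := by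
        intro v hv
        let P : V → Finset W := fun u => {y ∈ S v | T.Backward (θ u) (θ v) (φ u) y}
        have hVpos : 0 < Fintype.card V := Fintype.card_pos_iff.2 ⟨v⟩
        let D : Finset V := {u | G.connectedComponentMk u ∈ 𝒦}
        have h1 : S v \ A v ⊆ D.biUnion P := by
          intro y hy
          obtain ⟨hy1, hy2⟩ := mem_sdiff.1 hy
          by_contra hn
          refine hy2 (mem_filter.2 ⟨hy1, fun u hu hb => hn ?_⟩)
          exact mem_biUnion.2 ⟨u, by simpa [D] using hu, mem_filter.2 ⟨hy1, hb⟩⟩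
        have h2 : Fintype.card V * (2 * #(S v \ A v)) ≤ Fintype.card V * #(S v) := by
          calc Fintype.card V * (2 * #(S v \ A v))
              ≤ Fintype.card V * (2 * ∑ u ∈ D, #(P u)) := by
                gcongr
                exact (card_le_card h1).trans card_biUnion_le
            _ = ∑ u ∈ D, 2 * Fintype.card V * #(P u) := by rw [← mul_sum]; ring
            _ ≤ ∑ _u ∈ D, #(S v) := by
                refine sum_le_sum fun u hu => ?_
                have hu' : G.connectedComponentMk u ∈ 𝒦 := by simpa [D] using hu
                exact hsmooth u v (fun e => hk (hv ▸ e ▸ hu')) _ (hφS u hu')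
            _ = #D * #(S v) := by rw [sum_const, smul_eq_mul]
            _ ≤ _ := Nat.mul_le_mul_right _ (card_le_univ D)
        have h3 := Nat.le_of_mul_le_mul_left h2 hVpos
        have h0 : A v ⊆ S v := filter_subset _ _
        have h4 := card_sdiff_add_card_eq_card h0
        omega
      have hApos : ∀ v, G.connectedComponentMk v = k → 0 < #(A v) := fun v hv => by
        have h1 := hA v hv
        have h2 := hS v
        omega
      -- `Backward` also holds for two equal vertices, so distinctness is recorded separately.
      obtain ⟨ψ, hψA, hψ⟩ : ∃ ψ : V → W, (∀ v, G.connectedComponentMk v = k → ψ v ∈ A v) ∧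
          ∀ u v, G.connectedComponentMk u = k → ctr u → ¬ ctr v → G.Adj u v →
            T.Backward (θ u) (θ v) (ψ u) (ψ v) ∧ ψ u ≠ ψ v := by
        by_cases hc : ∃ c, ctr c ∧ G.connectedComponentMk c = k
        · obtain ⟨c, hc, hck⟩ := hc
          -- By `hmix`, the candidates for the center without a backward partner for a given leaf
          -- are fewer than `#(S c) / (2 |V|)`. The leaves together cannot rule out all of `A c`,
          -- which has at least `#(S c) / 2` elements. Once `x` is fixed, the leaves are chosen
          -- independently.
          obtain ⟨x, hxA, hx⟩ : ∃ x ∈ A c, ∀ l, ¬ ctr l → G.connectedComponentMk l = k →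
              ∃ y ∈ A l, T.Backward (θ c) (θ l) x y ∧ x ≠ y := by
            by_contra hcon
            push Not at hcon
            let D : Finset V := {l | ¬ ctr l ∧ G.connectedComponentMk l = k}
            let P : V → Finset W := fun l =>
              {x ∈ A c | ∀ y ∈ A l, T.Backward (θ c) (θ l) x y → x = y}
            have h1 : A c ⊆ D.biUnion P := by
              intro x hx
              obtain ⟨l, hl1, hl2, hl3⟩ := hcon x hx
              exact mem_biUnion.2 ⟨l, by simp [D, hl1, hl2], mem_filter.2 ⟨hx, hl3⟩⟩
            have h2 : ∀ l ∈ D, Fintype.card V * #(P l) + 1 ≤ #(A c) := by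
              intro l hl
              obtain ⟨hl1, hl2⟩ : ¬ ctr l ∧ G.connectedComponentMk l = k := by simpa [D] using hl
              by_contra hn
              have hSc := hA c hck
              obtain ⟨x, hx, y, hy, hxy, hne⟩ := hmix c l hc hl1 (P l)
                ((filter_subset _ _).trans (filter_subset _ _)) (A l) (filter_subset _ _)
                (by nlinarith) (hA l hl2)
              exact hne ((mem_filter.1 hx).2 y hy hxy)
            have h3 := sum_le_sum h2
            rw [sum_add_distrib, ← mul_sum, sum_const, sum_const, smul_eq_mul, smul_eq_mul] at h3
            have h4 : #(A c) ≤ ∑ l ∈ D, #(P l) := (card_le_card h1).trans card_biUnion_le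
            have h5 : #D ≤ Fintype.card V := card_le_univ D
            have h6 : 0 < #D := by
              obtain ⟨x, hx⟩ := card_pos.1 (hApos c hck)
              obtain ⟨l, hl, -⟩ := mem_biUnion.1 (h1 hx)
              exact card_pos.2 ⟨l, hl⟩
            have h7 : #D * #(A c) ≤ Fintype.card V * ∑ l ∈ D, #(P l) := Nat.mul_le_mul h5 h4
            omega
          have : Nonempty W := ⟨x⟩
          choose! y hyA hy using hx
          refine ⟨fun v => if ctr v then x else y v, fun v hv => ?_, fun u v hu hcu hv huv => ?_⟩
          · by_cases hcv : ctr v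
            · simp only [hcv, if_true]
              rwa [hctr v c hcv hc (hv.trans hck.symm)]
            · simp only [hcv, if_false]
              exact hyA v hcv hv
          · obtain rfl := hctr u c hcu hc (hu.trans hck.symm)
            simp only [hcu, hv, if_true, if_false]
            refine hy v hv ?_
            rw [← hu]
            exact (SimpleGraph.ConnectedComponent.connectedComponentMk_eq_of_adj huv).symm
        -- By `hleaf`, a component without a center has no edges, so any candidates will do.
        · have hne : ∀ v, ∃ y, G.connectedComponentMk v = k → y ∈ A v := by
            intro v
            obtain ⟨b, hb⟩ := card_pos.1 (hS v)
            by_cases hv : G.connectedComponentMk v = k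
            · obtain ⟨a, ha⟩ := card_pos.1 (hApos v hv)
              exact ⟨a, fun _ => ha⟩
            · exact ⟨b, fun h => absurd h hv⟩
          choose y hy using hne
          exact ⟨y, hy, fun u v hu hcu => absurd ⟨u, hcu, hu⟩ hc⟩
      have hAS : ∀ v, A v ⊆ S v := fun v => filter_subset _ _
      refine ⟨fun v => if G.connectedComponentMk v = k then ψ v else φ v, fun v hv => ?_,
        fun u v hu hv huv => ?_⟩
      · by_cases hvk : G.connectedComponentMk v = k
        · simp only [hvk, if_true]
          exact hAS v (hψA v hvk)
        · simp only [hvk, if_false]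
          exact hφS v ((mem_insert.1 hv).resolve_left hvk)
      · by_cases huk : G.connectedComponentMk u = k <;> by_cases hvk : G.connectedComponentMk v = k
        · simp only [huk, hvk, if_true]
          by_cases hG : G.Adj u v
          · have h1 := hgt u v huv hG
            by_cases hcu : ctr u
            · have hcv : ¬ ctr v := fun h => huv.ne (hctr u v hcu h (huk.trans hvk.symm))
              obtain ⟨h2, h3⟩ := hψ u v huk hcu hcv hG
              rcases h2 with h2 | h2
              · exact absurd h2.1 h1.not_gt
              · exact (T.adj_or_adj h3).resolve_right h2.2
            · have hcv : ctr v := by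
                by_contra h
                exact hleaf u v hcu h (huk.trans hvk.symm) hG
              obtain ⟨h2, h3⟩ := hψ v u hvk hcv hcu hG.symm
              rcases h2 with h2 | h2
              · exact (T.adj_or_adj h3).resolve_left h2.2
              · exact absurd h2.1 h1.not_gt
          · have hcu : ¬ ctr u := by
              intro h
              by_cases hcv : ctr v
              · exact huv.ne (hctr u v h hcv (huk.trans hvk.symm))
              · exact hG (hstar u v h hcv (huk.trans hvk.symm))
            have hcv : ¬ ctr v := fun h =>
              hG (hstar v u h hcu (hvk.trans huk.symm)).symm
            exact hsame u v hcu hcv (huk.trans hvk.symm) (hlt u v huv hG) _ (hAS u (hψA u huk)) _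
              (hAS v (hψA v hvk))
        · have hv' := (mem_insert.1 hv).resolve_left hvk
          have hG : ¬ G.Adj u v := fun h => hvk
            ((SimpleGraph.ConnectedComponent.connectedComponentMk_eq_of_adj h).symm.trans huk)
          simp only [huk, hvk, if_true, if_false]
          by_contra hn
          exact (mem_filter.1 (hψA u huk)).2 v hv' (Or.inr ⟨hlt u v huv hG, hn⟩)
        · have hu' := (mem_insert.1 hu).resolve_left huk
          have hG : ¬ G.Adj u v := fun h => huk
            ((SimpleGraph.ConnectedComponent.connectedComponentMk_eq_of_adj h).trans hvk)
          simp only [huk, hvk, if_true, if_false]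
          by_contra hn
          exact (mem_filter.1 (hψA v hvk)).2 u hu' (Or.inl ⟨hlt u v huv hG, hn⟩)
        · simp only [huk, hvk, if_false]
          exact hφ u v ((mem_insert.1 hu).resolve_left huk) ((mem_insert.1 hv).resolve_left hvk) huv
  obtain ⟨φ, -, hφ⟩ := key (univ.image G.connectedComponentMk)
  exact ⟨φ, fun u v => hφ u v (mem_image_of_mem _ (mem_univ _)) (mem_image_of_mem _ (mem_univ _))⟩

/-! ### Centers and blocks of a galaxy ordering -/

/-- The centers of the stars of a galaxy ordering. -/
theorem IsGalaxyOrdering.exists_centers [Fintype V] {H : Tournament V}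
    {θ : V ≃ Fin (Fintype.card V)} (h : H.IsGalaxyOrdering θ) :
    ∃ ctr : V → Prop,
      (∀ u v, ctr u → ctr v → (H.backwardGraph θ).connectedComponentMk u =
        (H.backwardGraph θ).connectedComponentMk v → u = v) ∧
      (∀ u v, ¬ ctr u → ¬ ctr v → (H.backwardGraph θ).connectedComponentMk u =
        (H.backwardGraph θ).connectedComponentMk v → ¬ (H.backwardGraph θ).Adj u v) ∧
      (∀ u v, ctr u → ¬ ctr v → (H.backwardGraph θ).connectedComponentMk u =
        (H.backwardGraph θ).connectedComponentMk v → (H.backwardGraph θ).Adj u v) ∧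
      ∀ u v, ¬ ctr u → ¬ ctr v → (H.backwardGraph θ).connectedComponentMk u =
        (H.backwardGraph θ).connectedComponentMk v → ∀ c, ctr c → ¬ IsBetween θ c u v := by
  replace h := h.2
  set G := H.backwardGraph θ
  obtain ⟨center, hcen, hbet⟩ := h
  have hmem : ∀ v, v ∈ (G.connectedComponentMk v).supp := fun v => rfl
  have hadj : ∀ K : G.ConnectedComponent, K.supp.Nontrivial → ∀ u ∈ K.supp, ∀ v ∈ K.supp,
      (G.Adj u v ↔ u ≠ v ∧ (u = center K ∨ v = center K)) := by
    intro K hK u hu v hv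
    obtain ⟨hc, hstar⟩ : ∃ hc : center K ∈ K.supp,
        G.induce K.supp = SimpleGraph.starGraph ⟨center K, hc⟩ := by
      rcases hcen K hK with h | h <;> exact h.1.2
    have h1 : (G.induce K.supp).Adj ⟨u, hu⟩ ⟨v, hv⟩ ↔
      (SimpleGraph.starGraph (⟨center K, hc⟩ : K.supp)).Adj ⟨u, hu⟩ ⟨v, hv⟩ := by rw [hstar]
    simpa [SimpleGraph.starGraph_adj, Subtype.ext_iff] using h1
  have hnt : ∀ u v, G.connectedComponentMk u = G.connectedComponentMk v → u ≠ v →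
      (G.connectedComponentMk u).supp.Nontrivial := fun u v huv hne =>
    ⟨u, hmem u, v, huv.symm, hne⟩
  refine ⟨fun v => (G.connectedComponentMk v).supp.Nontrivial ∧
    center (G.connectedComponentMk v) = v, ?_, ?_, ?_, ?_⟩
  · rintro u v ⟨-, hu⟩ ⟨-, hv⟩ huv
    rw [← hu, ← hv, huv]
  · intro u v hu hv huv hA
    have hK := hnt u v huv hA.ne
    rcases ((hadj _ hK u (hmem u) v huv.symm).1 hA).2 with h | h
    · exact hu ⟨hK, h.symm⟩
    · exact hv ⟨huv ▸ hK, by rw [← huv]; exact h.symm⟩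
  · rintro u v ⟨hK, hu⟩ hv huv
    refine (hadj _ hK u (hmem u) v huv.symm).2 ⟨?_, Or.inl hu.symm⟩
    rintro rfl
    exact hv ⟨hK, hu⟩
  · rintro u v hu hv huv c ⟨hK, hc⟩ hb
    have hne : u ≠ v := by
      rintro rfl
      rcases hb with hb | hb <;> exact absurd (hb.1.trans hb.2) (lt_irrefl _)
    have hL := hnt u v huv hne
    have hu' : u ≠ center (G.connectedComponentMk u) := fun e => hu ⟨hL, e.symm⟩
    have hv' : v ≠ center (G.connectedComponentMk u) := fun e =>
      hv ⟨huv ▸ hL, by rw [← huv]; exact e.symm⟩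
    -- The galaxy condition concerns centers of other stars; the star's own center is not between
    -- its leaves because they all lie on one side of it.
    by_cases hcu : G.connectedComponentMk c = G.connectedComponentMk u
    · rw [← hcu, hc] at hu' hv'
      have hstar := hcen _ hK
      rw [hc] at hstar
      have hum : u ∈ (G.connectedComponentMk c).supp := hcu.symm
      have hvm : v ∈ (G.connectedComponentMk c).supp := (hcu.trans huv).symm
      rcases hstar with h | h
      · have h1 := h.2 u hum hu'
        have h2 := h.2 v hvm hv'
        rcases hb with hb | hb
        · exact hb.1.asymm h1
        · exact hb.1.asymm h2
      · have h1 := h.2 u hum hu'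
        have h2 := h.2 v hvm hv'
        rcases hb with hb | hb
        · exact hb.2.asymm h2
        · exact hb.2.asymm h1
    · have := hbet _ _ hcu hK hL u (hmem u) hu' v huv.symm hv'
      rw [hc] at this
      exact this hb

/-- The blocks of a galaxy ordering: centers are alone in odd blocks, and the vertices between
consecutive centers are in a common even block. -/
theorem exists_blocks [Fintype V] (θ : V ≃ Fin (Fintype.card V)) (ctr : V → Prop) :
    ∃ b : V → ℕ, (∀ v, b v < 2 * Fintype.card V + 1) ∧ (∀ v, ctr v → Odd (b v)) ∧
      (∀ v, ¬ ctr v → Even (b v)) ∧ (∀ u v, θ u < θ v → b u ≤ b v) ∧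
      (∀ u v, u ≠ v → b u = b v → ¬ ctr u ∧ ¬ ctr v) ∧
      ∀ u v, ¬ ctr u → ¬ ctr v → (∀ c, ctr c → ¬ IsBetween θ c u v) → b u = b v := by
  let B : V → Finset V := fun v => {c | ctr c ∧ θ c < θ v}
  have hmono : ∀ u v, θ u < θ v → #(B u) ≤ #(B v) := by
    refine fun u v huv => card_le_card fun c hc => ?_
    simp only [B, mem_filter, mem_univ, true_and] at hc ⊢
    exact ⟨hc.1, hc.2.trans huv⟩
  have hstrict : ∀ u v, θ u < θ v → ctr u → #(B u) < #(B v) := by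
    refine fun u v huv hu => card_lt_card ⟨fun c hc => ?_, fun hs => ?_⟩
    · simp only [B, mem_filter, mem_univ, true_and] at hc ⊢
      exact ⟨hc.1, hc.2.trans huv⟩
    · have : u ∈ B u := hs (by simp [B, hu, huv])
      simp [B] at this
  have hle : ∀ v, #(B v) < Fintype.card V := by
    intro v
    refine card_lt_univ_of_notMem (x := v) ?_
    simp [B]
  -- Passing a center raises twice the number of earlier centers by 2, which leaves an odd value
  -- free for the center alone.
  let b : V → ℕ := fun v => 2 * #(B v) + if ctr v then 1 else 0
  have hpos : ∀ v, ctr v → b v = 2 * #(B v) + 1 := fun v hv => by simp [b, hv]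
  have hneg : ∀ v, ¬ ctr v → b v = 2 * #(B v) := fun v hv => by simp [b, hv]
  have hlt : ∀ u v, θ u < θ v → b u ≤ b v ∧ (b u = b v → ¬ ctr u ∧ ¬ ctr v) := by
    intro u v huv
    have h1 := hmono u v huv
    have h2 := hstrict u v huv
    by_cases hu : ctr u <;> by_cases hv : ctr v
    · rw [hpos u hu, hpos v hv]
      have := h2 hu
      exact ⟨by omega, fun h => by omega⟩
    · rw [hpos u hu, hneg v hv]
      have := h2 hu
      exact ⟨by omega, fun h => by omega⟩
    · rw [hneg u hu, hpos v hv]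
      exact ⟨by omega, fun h => by omega⟩
    · rw [hneg u hu, hneg v hv]
      exact ⟨by omega, fun h => ⟨hu, hv⟩⟩
  refine ⟨b, fun v => ?_, fun v hv => ?_, fun v hv => ?_, fun u v huv => (hlt u v huv).1,
    fun u v hne he => ?_, fun u v hu hv hb => ?_⟩
  · have := hle v
    by_cases hv : ctr v
    · rw [hpos v hv]
      omega
    · rw [hneg v hv]
      omega
  · rw [hpos v hv]
    exact odd_two_mul_add_one _
  · rw [hneg v hv]
    exact even_two_mul _
  · rcases lt_or_gt_of_ne (θ.injective.ne hne) with h | h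
    · exact (hlt u v h).2 he
    · exact ((hlt v u h).2 he.symm).symm
  · rw [hneg u hu, hneg v hv]
    congr 2
    ext c
    simp only [B, mem_filter, mem_univ, true_and]
    refine and_congr_right fun hc => ?_
    have hcu : θ c ≠ θ u := fun e => hu (θ.injective e ▸ hc)
    have hcv : θ c ≠ θ v := fun e => hv (θ.injective e ▸ hc)
    constructor
    · intro h
      by_contra hn
      exact hb c hc (Or.inr ⟨lt_of_le_of_ne (not_lt.1 hn) hcv.symm, h⟩)
    · intro h
      by_contra hn
      exact hb c hc (Or.inl ⟨lt_of_le_of_ne (not_lt.1 hn) hcu.symm, h⟩)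

/-! ### Embedding a galaxy into the sequence of sets -/

/-- A tournament in which large sets contain transitive sets of size `8 |H| g`, and large sets
are not complete to or from transitive sets of size `g`, contains the galaxy `H`. -/
theorem IsGalaxy.not_isFree [Fintype V] [Nonempty V] {T : Tournament W} {H : Tournament V}
    (hgal : H.IsGalaxy) {U₀ : Finset W} {h L N g : ℕ} (hh : h = Fintype.card V)
    (hL : L = 2 * h + 1) (hN : 4 * L ^ 2 * h ≤ N) (hg : 0 < g)
    (htrans : ∀ Y ⊆ U₀, 8 * h * N ≤ #Y → ∃ Z ⊆ Y, T.TransOn Z ∧ 8 * h * g ≤ #Z)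
    (hpure : ∀ X ⊆ U₀, ∀ Y ⊆ U₀, 2 * N ≤ #X → g ≤ #Y → T.TransOn Y →
      (∃ x ∈ X, ∃ y ∈ Y, T.Adj x y) ∧ ∃ x ∈ X, ∃ y ∈ Y, T.Adj y x)
    (hU₀ : 8 * h * N * (2 * (h * (8 * L ^ 2 * (8 * h ^ 2)) ^ h)) ^ L ≤ #U₀) :
    ¬ T.IsFree H := by
  intro hfree
  have hpos : 0 < h := hh ▸ Fintype.card_pos
  obtain ⟨θ, hθ⟩ := hgal
  obtain ⟨ctr, hc1, hc2, hc3, hc4⟩ := hθ.exists_centers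
  obtain ⟨b, hb1, hb2, hb3, hb4, hb5, hb6⟩ := exists_blocks θ ctr
  -- With `K = 8 * h ^ 2` the bad vertices are at most a fraction 1 / (4h²) of `Z q`, hence at most
  -- 1 / (2h) of a subset that has a 1 / (2h) share of it.
  obtain ⟨Z, hZ, hZs⟩ := hfree.exists_smooth_sequence (U₀ := U₀) (K := 8 * h ^ 2) (L := L)
    (N := 8 * h * N) (G := 8 * h * g) (by positivity) (by omega)
    (by calc 4 * (L ^ 2 * (8 * h ^ 2)) = 8 * h * (4 * L ^ 2 * h) := by ring
          _ ≤ _ := Nat.mul_le_mul_left _ hN) (by positivity) htrans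
    (by rwa [← hh])
  have hbL : ∀ v, b v < L := fun v => by rw [hL, hh]; exact hb1 v
  have hrank : ∀ p, ∃ r : W → ℕ, p < L → Even p → (∀ x ∈ Z p, ∀ y ∈ Z p, r x < r y → T.Adj x y) ∧
      ∀ i t, i + t ≤ #(Z p) → #{z ∈ Z p | i ≤ r z ∧ r z < i + t} = t := by
    intro p
    by_cases hp : p < L ∧ Even p
    · obtain ⟨r, hr⟩ := ((hZ p hp.1).2.2.2 hp.2).1.exists_rank
      exact ⟨r, fun _ _ => hr⟩
    · exact ⟨fun _ => 0, fun h1 h2 => absurd ⟨h1, h2⟩ hp⟩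
  choose r hr using hrank
  let t : ℕ → ℕ := fun p => #(Z p) / h
  -- A center receives a whole set; any other vertex receives the slice of ranks indexed by its
  -- position in `θ`, so slices of one block are ordered as `θ` prescribes.
  let S : V → Finset W := fun v => if ctr v then Z (b v) else
    {z ∈ Z (b v) | θ v * t (b v) ≤ r (b v) z ∧ r (b v) z < θ v * t (b v) + t (b v)}
  have hSc : ∀ v, ctr v → S v = Z (b v) := fun v hv => by simp [S, hv]
  have hSl : ∀ v, ¬ ctr v → S v =
    {z ∈ Z (b v) | θ v * t (b v) ≤ r (b v) z ∧ r (b v) z < θ v * t (b v) + t (b v)} :=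
    fun v hv => by simp [S, hv]
  have hSZ : ∀ v, S v ⊆ Z (b v) := by
    intro v
    by_cases hv : ctr v
    · rw [hSc v hv]
    · rw [hSl v hv]
      exact filter_subset _ _
  have hScard : ∀ v, #(Z (b v)) ≤ 2 * h * #(S v) := by
    intro v
    by_cases hv : ctr v
    · rw [hSc v hv]
      exact Nat.le_mul_of_pos_left _ (by omega)
    · have h1 : #(S v) = t (b v) := by
        rw [hSl v hv]
        refine (hr _ (hbL v) (hb3 v hv)).2 _ _ ?_
        have h2 : (θ v : ℕ) + 1 ≤ h := hh ▸ (θ v).2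
        calc (θ v : ℕ) * t (b v) + t (b v) = (θ v + 1) * t (b v) := by ring
          _ ≤ h * t (b v) := Nat.mul_le_mul_right _ h2
          _ ≤ #(Z (b v)) := Nat.mul_div_le _ _
      have h2 : 8 * h * g ≤ 2 * #(Z (b v)) := ((hZ _ (hbL v)).2.2.2 (hb3 v hv)).2
      -- A slice is therefore nonempty, and rounding `#(Z (b v)) / h` down loses at most a factor 2.
      have h3 : h ≤ #(Z (b v)) := by nlinarith
      have h4 : 1 ≤ t (b v) := (Nat.one_le_div_iff hpos).2 h3
      have h5 : #(Z (b v)) < h * t (b v) + h := by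
        have := Nat.lt_mul_div_succ #(Z (b v)) hpos
        rwa [mul_add, mul_one] at this
      rw [h1]
      nlinarith
  have hSpos : ∀ v, 0 < #(S v) := fun v => by
    have h1 := hScard v
    have h2 := (hZ _ (hbL v)).2.1
    exact Nat.pos_of_mul_pos_left (h2.trans_le h1)
  have hsame : ∀ u v, ¬ ctr u → ¬ ctr v → b u = b v → θ u < θ v →
      ∀ x ∈ S u, ∀ y ∈ S v, T.Adj x y := by
    intro u v hu hv huv hlt x hx y hy
    rw [hSl u hu] at hx
    rw [hSl v hv, ← huv] at hy
    obtain ⟨hx1, hx2⟩ := mem_filter.1 hx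
    obtain ⟨hy1, hy2⟩ := mem_filter.1 hy
    refine (hr _ (hbL u) (hb3 u hu)).1 x hx1 y hy1 (lt_of_lt_of_le hx2.2 (le_trans ?_ hy2.1))
    have h2 : (θ u : ℕ) + 1 ≤ θ v := hlt
    calc (θ u : ℕ) * t (b u) + t (b u) = (θ u + 1) * t (b u) := by ring
      _ ≤ _ := Nat.mul_le_mul_right _ h2
  obtain ⟨φ, hφ⟩ := exists_hom_of_stars (T := T) (H := H) (G := H.backwardGraph θ) (θ := θ)
    (ctr := ctr) (S := S) θ.injective
    (by
      intro u v huv hA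
      have hne : u ≠ v := fun e => huv.ne (congrArg θ e)
      exact (H.adj_or_adj hne).resolve_right fun h1 => hA (Or.inr ⟨h1, huv⟩))
    (by
      rintro u v huv (hA | hA)
      · exact absurd hA.2 huv.asymm
      · exact hA.1)
    hc1 hc2 hc3 hSpos
    (by
      intro u v huv x hx
      have hne : u ≠ v := fun e => huv (congrArg _ e)
      refine le_trans (Nat.mul_le_mul_right _ (Nat.mul_le_mul_left 2 hh.ge)) ?_
      by_cases hbuv : b u = b v
      · obtain ⟨hu, hv⟩ := hb5 u v hne hbuv
        have h0 : #{y ∈ S v | T.Backward (θ u) (θ v) x y} = 0 := by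
          rw [card_eq_zero, filter_eq_empty_iff]
          rintro y hy (hxy | hxy)
          · exact hxy.2 (hsame u v hu hv hbuv hxy.1 x hx y hy)
          · exact hxy.2 (hsame v u hv hu hbuv.symm hxy.1 y hy x hx)
        rw [h0]
        exact Nat.zero_le _
      · have h1 := hZs _ (hbL u) _ (hbL v) hbuv x (hSZ u hx)
        have h2 : #{y ∈ S v | T.Backward (θ u) (θ v) x y} ≤
            #{y ∈ Z (b v) | T.Backward (b u) (b v) x y} := by
          refine card_le_card fun y hy => ?_
          obtain ⟨hy1, hy2⟩ := mem_filter.1 hy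
          refine mem_filter.2 ⟨hSZ v hy1, ?_⟩
          rcases hy2 with hy2 | hy2
          · exact Or.inl ⟨lt_of_le_of_ne (hb4 u v hy2.1) hbuv, hy2.2⟩
          · exact Or.inr ⟨lt_of_le_of_ne (hb4 v u hy2.1) (Ne.symm hbuv), hy2.2⟩
        refine Nat.le_of_mul_le_mul_left (?_ : 4 * h * _ ≤ 4 * h * _) (by positivity)
        calc 4 * h * (2 * h * #{y ∈ S v | T.Backward (θ u) (θ v) x y})
            = 8 * h ^ 2 * #{y ∈ S v | T.Backward (θ u) (θ v) x y} := by ring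
          _ ≤ 8 * h ^ 2 * #{y ∈ Z (b v) | T.Backward (b u) (b v) x y} :=
              Nat.mul_le_mul_left _ h2
          _ ≤ 2 * #(Z (b v)) := h1
          _ ≤ 2 * (2 * h * #(S v)) := Nat.mul_le_mul_left _ (hScard v)
          _ = _ := by ring)
    (fun u v hu hv huv => hsame u v hu hv (hb6 u v hu hv (hc4 u v hu hv huv)))
    (by
      intro c l hc hl X hX Y hY hXc hYc
      rw [← hh] at hXc
      have hZc := hZ _ (hbL c)
      have hZl := hZ _ (hbL l)
      have hN1 := hZc.2.2.1 (hb2 c hc)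
      have hG1 := hZl.2.2.2 (hb3 l hl)
      rw [← hSc c hc] at hN1
      -- `S c` has at least `4 * h * N` vertices, of which `X` keeps a share 1 / (2h). Likewise `S
      -- l` has at least `2 * g`, of which `Y` keeps half.
      have hX1 : 2 * N ≤ #X := by
        refine Nat.le_of_mul_le_mul_left (?_ : 4 * h * _ ≤ 4 * h * _) (by positivity)
        nlinarith
      have hY1 : g ≤ #Y := by
        refine Nat.le_of_mul_le_mul_left (?_ : 8 * h * _ ≤ 8 * h * _) (by positivity)
        have := hScard l
        nlinarith
      obtain ⟨⟨x, hx, y, hy, hxy⟩, ⟨x', hx', y', hy', hxy'⟩⟩ := hpure X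
        (hX.trans ((hSZ c).trans hZc.1)) Y (hY.trans ((hSZ l).trans hZl.1)) hX1 hY1
        (hG1.1.mono (hY.trans (hSZ l)))
      have hne : c ≠ l := fun e => hl (e ▸ hc)
      rcases lt_or_gt_of_ne (θ.injective.ne hne) with hlt | hlt
      · exact ⟨x', hx', y', hy', Or.inl ⟨hlt, hxy'.asymm⟩, hxy'.ne.symm⟩
      · exact ⟨x, hx, y, hy, Or.inr ⟨hlt, hxy.asymm⟩, hxy.ne⟩)
  exact not_isFree_of_hom φ hφ hfree

/-! ### Numerical estimates and choice of parameters -/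

theorem one_sub_mul_log_le_rpow_neg {b ε : ℝ} (hb : 0 < b) : 1 - ε * Real.log b ≤ b ^ (-ε) := by
  rw [Real.rpow_def_of_pos hb]
  have := Real.add_one_le_exp (Real.log b * -ε)
  linarith

/-- For small ε, shrinking a set by a factor `b` costs its ε-th power only the relative loss ε log
b. -/
theorem rpow_mul_one_sub_le {n m b ε : ℝ} (hb : 0 < b) (hn : 0 ≤ n) (hε : 0 ≤ ε)
    (h : n ≤ b * m) : n ^ ε * (1 - ε * Real.log b) ≤ m ^ ε := by
  have h1 : n / b ≤ m := (div_le_iff₀' hb).2 h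
  calc n ^ ε * (1 - ε * Real.log b) ≤ n ^ ε * b ^ (-ε) :=
        mul_le_mul_of_nonneg_left (one_sub_mul_log_le_rpow_neg hb) (Real.rpow_nonneg hn _)
    _ = (n / b) ^ ε := by
        rw [Real.div_rpow hn hb.le, Real.rpow_neg hb.le, div_eq_mul_inv]
    _ ≤ m ^ ε := Real.rpow_le_rpow (by positivity) h1 hε

theorem le_size_bound {h L B : ℕ} (hpos : 0 < h) (hL : L = 2 * h + 1)
    (hB : B = 8 * h * (2 * (h * (8 * L ^ 2 * (8 * h ^ 2)) ^ h)) ^ L) : 4 * L ^ 2 * h ≤ B := by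
  rw [hB]
  have h1 : L ^ 2 ≤ 8 * L ^ 2 * (8 * h ^ 2) := by nlinarith [pow_pos hpos 2]
  have h2 : 8 * L ^ 2 * (8 * h ^ 2) ≤ (8 * L ^ 2 * (8 * h ^ 2)) ^ h :=
    Nat.le_self_pow hpos.ne' _
  have h3 : (8 * L ^ 2 * (8 * h ^ 2)) ^ h ≤ 2 * (h * (8 * L ^ 2 * (8 * h ^ 2)) ^ h) := by
    nlinarith [Nat.zero_le ((8 * L ^ 2 * (8 * h ^ 2)) ^ h)]
  have h4 : 2 * (h * (8 * L ^ 2 * (8 * h ^ 2)) ^ h) ≤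
      (2 * (h * (8 * L ^ 2 * (8 * h ^ 2)) ^ h)) ^ L := Nat.le_self_pow (by omega) _
  calc 4 * L ^ 2 * h ≤ 8 * h * L ^ 2 := by nlinarith [Nat.zero_le (h * L ^ 2)]
    _ ≤ _ := Nat.mul_le_mul_left _ (h1.trans (h2.trans (h3.trans h4)))

/-- Take N = ⌊n / B⌋ and g = ⌊n^ε / (16h)⌋. Then N^ε ≥ (1 - 1 / (64h)) n^ε, and g ≥ n^ε / (32h) more
than makes up for the loss, while 8hg ≤ n^ε / 2 ≤ N^ε. -/
theorem exists_parameters {n h B : ℕ} {ε : ℝ} (hpos : 0 < h) (hB36 : 36 ≤ B) (hε : 0 < ε)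
    (hε1 : ε ≤ 1) (hlog : 1 ≤ Real.log (2 * B)) (hη : ε * Real.log (2 * B) * (64 * h) ≤ 1)
    (hM16 : 16 * h ≤ (n : ℝ) ^ ε) :
    ∃ N g : ℕ, B ≤ N ∧ B * N ≤ n ∧ 0 < g ∧ g ≤ N ∧ 8 * h * (g : ℝ) ≤ (N : ℝ) ^ ε ∧
      (n : ℝ) ^ ε ≤ (N : ℝ) ^ ε + g := by
  have hh1 : (1 : ℝ) ≤ h := by exact_mod_cast hpos
  have hB36' : (36 : ℝ) ≤ B := by exact_mod_cast hB36
  have hn1 : (0 : ℝ) < n := by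
    have h0 : n ≠ 0 := by
      rintro rfl
      rw [Nat.cast_zero, Real.zero_rpow hε.ne'] at hM16
      linarith
    exact_mod_cast Nat.pos_of_ne_zero h0
  set M : ℝ := (n : ℝ) ^ ε with hM
  have hMpos : 0 < M := by linarith
  -- Since n^ε ≥ 16h > e, we have ε log n ≥ 1 ≥ 64h · ε log(2B), so n is at least (2B)².
  have hnB : (B : ℝ) * B ≤ (n : ℝ) := by
    have hn0 := hn1
    have h1 : 1 ≤ Real.log M := by
      rw [Real.le_log_iff_exp_le hMpos]
      have := Real.exp_one_lt_d9
      linarith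
    rw [hM, Real.log_rpow hn0] at h1
    have h2 : 2 * Real.log (2 * B) ≤ Real.log n := by
      by_contra hlt
      have h3 : ε * Real.log n ≤ ε * (2 * Real.log (2 * B)) :=
        mul_le_mul_of_nonneg_left (not_le.1 hlt).le hε.le
      have h4 : 0 ≤ ε * Real.log (2 * B) := mul_nonneg hε.le (by linarith)
      nlinarith
    have h3 : Real.log ((2 * B) ^ 2) ≤ Real.log n := by
      rw [Real.log_pow]
      exact_mod_cast h2
    have h4 := (Real.log_le_log_iff (by positivity) hn0).1 h3
    nlinarith
  have hnB' : B * B ≤ n := by exact_mod_cast hnB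
  obtain ⟨N, hN⟩ : ∃ N, N = n / B := ⟨_, rfl⟩
  have hBpos : 0 < B := by omega
  have hBN : B ≤ N := hN ▸ (Nat.le_div_iff_mul_le hBpos).2 hnB'
  have hNB : B * N ≤ n := hN ▸ Nat.mul_div_le _ _
  have hNU : (n : ℝ) ≤ 2 * B * (N : ℝ) := by
    have h1 : n < B * (N + 1) := hN ▸ Nat.lt_mul_div_succ _ hBpos
    have h2 : n ≤ 2 * B * N := by nlinarith
    exact_mod_cast h2
  have hNε : M * (1 - ε * Real.log (2 * B)) ≤ (N : ℝ) ^ ε :=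
    rpow_mul_one_sub_le (by positivity) (by linarith) hε.le hNU
  have hNε2 : M * (64 * h) - M ≤ (N : ℝ) ^ ε * (64 * h) := by nlinarith
  obtain ⟨g, hg⟩ : ∃ g, g = ⌊M / (16 * h)⌋₊ := ⟨_, rfl⟩
  have hx1 : 1 ≤ M / (16 * h) := (one_le_div (by positivity)).2 hM16
  have hgpos : 0 < g := hg ▸ Nat.floor_pos.2 hx1
  have hg1 : (g : ℝ) ≤ M / (16 * h) := hg ▸ Nat.floor_le (by linarith)
  have hg2 : M / (16 * h) < g + 1 := hg ▸ Nat.lt_floor_add_one _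
  have hgM : 8 * h * (g : ℝ) ≤ (N : ℝ) ^ ε := by
    rw [le_div_iff₀ (by positivity)] at hg1
    nlinarith
  have hgN : M ≤ (N : ℝ) ^ ε + g := by
    have h1 : (1 : ℝ) ≤ g := by exact_mod_cast hgpos
    have h2 : M / (16 * h) ≤ 2 * g := by linarith
    rw [div_le_iff₀ (by positivity)] at h2
    have h3 : M * (64 * h) ≤ ((N : ℝ) ^ ε + g) * (64 * h) := by nlinarith
    exact le_of_mul_le_mul_right h3 (by positivity)
  have hgleN : g ≤ N := by
    have h1 : (1 : ℝ) ≤ N := by exact_mod_cast (by omega : 1 ≤ N)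
    have h2 : (N : ℝ) ^ ε ≤ N := by
      simpa using Real.rpow_le_rpow_of_exponent_le h1 hε1
    have h3 : (g : ℝ) ≤ 8 * h * g := by nlinarith [(Nat.cast_nonneg g : (0 : ℝ) ≤ g)]
    exact_mod_cast h3.trans (hgM.trans h2)
  exact ⟨N, g, hBN, hNB, hgpos, hgleN, hgM, hgN⟩

/-! ### The minimal counterexample -/

/-- A galaxy on `h` vertices satisfies the Erdős–Hajnal conjecture with an explicit exponent. -/
theorem IsGalaxy.exists_transOn [Fintype V] [Nonempty V] [Fintype W] {T : Tournament W}
    {H : Tournament V} (hgal : H.IsGalaxy) (hfree : T.IsFree H) {h L B : ℕ}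
    (hh : h = Fintype.card V) (hL : L = 2 * h + 1)
    (hB : B = 8 * h * (2 * (h * (8 * L ^ 2 * (8 * h ^ 2)) ^ h)) ^ L) {ε : ℝ} (hε : 0 < ε)
    (hεB : ε * (64 * h * Real.log (2 * B)) ≤ 1) :
    ∃ S : Finset W, T.TransOn S ∧ (Fintype.card W : ℝ) ^ ε ≤ #S := by
  by_contra hno
  have hpos : 0 < h := hh ▸ Fintype.card_pos
  have hne : {U : Finset W | ∀ S ⊆ U, T.TransOn S → (#S : ℝ) < (#U : ℝ) ^ ε}.Nonempty := by
    refine ⟨univ, fun S _ hS => ?_⟩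
    by_contra hn
    exact hno ⟨S, hS, by simpa using hn⟩
  obtain ⟨U, hU, hmin⟩ := wellFounded_lt.has_min _ hne
  have hbig : ∀ X, X ⊂ U → ∃ S ⊆ X, T.TransOn S ∧ (#X : ℝ) ^ ε ≤ #S := by
    intro X hX
    by_contra hn
    refine hmin X (fun S hS hT => ?_) hX
    by_contra h'
    exact hn ⟨S, hS, hT, not_lt.1 h'⟩
  have hcomplete : ∀ X ⊆ U, ∀ Y ⊆ U, Y.Nonempty → T.TransOn Y →
      ((∀ x ∈ X, ∀ y ∈ Y, T.Adj x y) ∨ ∀ x ∈ X, ∀ y ∈ Y, T.Adj y x) →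
      (#X : ℝ) ^ ε + #Y < (#U : ℝ) ^ ε := by
    intro X hX Y hY hYne hYT hXY
    have hdisj : Disjoint X Y := by
      rw [disjoint_left]
      intro a ha hb
      rcases hXY with h1 | h1 <;> exact T.loopless a (h1 a ha a hb)
    have hXU : X ⊂ U := by
      refine hX.ssubset_of_ne fun e => ?_
      obtain ⟨y, hy⟩ := hYne
      exact disjoint_left.1 hdisj (e ▸ hY hy) hy
    obtain ⟨S, hS, hST, hSc⟩ := hbig X hXU
    have h2 : T.TransOn (S ∪ Y) := by
      rcases hXY with h1 | h1
      · exact hST.union hYT fun x hx => h1 x (hS hx)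
      · rw [union_comm]
        exact hYT.union hST fun y hy x hx => h1 x (hS hx) y hy
    have h3 := hU (S ∪ Y) (union_subset (hS.trans hX) hY) h2
    rw [card_union_of_disjoint (disjoint_of_subset_left hS hdisj)] at h3
    push_cast at h3
    linarith
  have hn2 : 2 ≤ #U := by
    have h0 := hU ∅ (empty_subset _) (fun a ha => absurd ha (notMem_empty a))
    by_contra hn
    rcases (by omega : #U = 0 ∨ #U = 1) with h1 | h1
    · rw [h1] at h0
      simp [hε.ne'] at h0
    · obtain ⟨a, ha⟩ := card_eq_one.1 h1
      have h2 := hU {a} ha.ge (T.transOn_singleton a)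
      simp [h1] at h2
  set n : ℝ := (#U : ℝ) with hn
  set M : ℝ := n ^ ε with hM
  have hn2' : (2 : ℝ) ≤ n := by rw [hn]; exact_mod_cast hn2
  have hh1 : (1 : ℝ) ≤ h := by exact_mod_cast hpos
  have hB8 := le_size_bound hpos hL hB
  have hB36 : 36 ≤ B := le_trans (by rw [hL]; nlinarith [pow_pos hpos 2]) hB8
  have hB36' : (36 : ℝ) ≤ B := by exact_mod_cast hB36
  have hlog : 1 ≤ Real.log (2 * B) := by
    rw [Real.le_log_iff_exp_le (by linarith)]
    have := Real.exp_one_lt_d9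
    linarith
  have hη : ε * Real.log (2 * B) * (64 * h) ≤ 1 := by linarith
  have hε64 : ε * (64 * h) ≤ 1 := by
    refine le_trans ?_ hη
    have : ε * 1 ≤ ε * Real.log (2 * B) := mul_le_mul_of_nonneg_left hlog hε.le
    nlinarith
  have hε1 : ε ≤ 1 := by nlinarith
  -- The larger neighborhood of a vertex `v` has at least n / 4 vertices. Applied to it and `{v}`,
  -- `hcomplete` gives 1 < n^ε · ε log 4 ≤ 3ε n^ε, and ε ≤ 1 / (64h).
  have hM16 : 16 * h ≤ M := by
    obtain ⟨v, hv⟩ := card_pos.1 (by omega : 0 < #U)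
    have hsplit : #U ≤ #{x ∈ U | T.Adj x v} + #{x ∈ U | T.Adj v x} + 1 := by
      have h1 : U ⊆ {x ∈ U | T.Adj x v} ∪ {x ∈ U | T.Adj v x} ∪ {v} := by
        intro x hx
        by_cases hxv : x = v
        · simp [hxv]
        · rcases T.adj_or_adj hxv with h2 | h2 <;> simp [hx, h2]
      refine (card_le_card h1).trans ((card_union_le _ _).trans ?_)
      exact Nat.add_le_add (card_union_le _ _) (card_singleton v).le
    have hX : ∃ X ⊆ U, #U ≤ 4 * #X ∧
        ((∀ x ∈ X, ∀ y ∈ ({v} : Finset W), T.Adj x y) ∨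
          ∀ x ∈ X, ∀ y ∈ ({v} : Finset W), T.Adj y x) := by
      rcases le_total #{x ∈ U | T.Adj x v} #{x ∈ U | T.Adj v x} with h1 | h1
      · exact ⟨_, filter_subset (fun x => T.Adj v x) U, by omega, Or.inr fun x hx y hy => by
          rw [mem_singleton.1 hy]
          exact (mem_filter.1 hx).2⟩
      · exact ⟨_, filter_subset (fun x => T.Adj x v) U, by omega, Or.inl fun x hx y hy => by
          rw [mem_singleton.1 hy]
          exact (mem_filter.1 hx).2⟩
    obtain ⟨X, hXU, hXc, hX⟩ := hX
    have h2 := hcomplete X hXU {v} (by simpa using hv) (singleton_nonempty v)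
      (T.transOn_singleton v) hX
    have h3 : n ^ ε * (1 - ε * Real.log 4) ≤ (#X : ℝ) ^ ε :=
      rpow_mul_one_sub_le (by norm_num) (by linarith) hε.le (by rw [hn]; exact_mod_cast hXc)
    have h4 : Real.log 4 ≤ 3 := by
      have := Real.log_le_sub_one_of_pos (show (0 : ℝ) < 4 by norm_num)
      linarith
    rw [card_singleton] at h2
    push_cast at h2
    have h5 : M * (ε * Real.log 4) ≤ M * (ε * 3) := by gcongr
    have h6 : 1 < M * (ε * 3) := by
      rw [← hM] at h3
      nlinarith
    by_contra hlt
    have h7 : M * (ε * 3) ≤ 16 * h * (ε * 3) :=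
      mul_le_mul_of_nonneg_right (not_le.1 hlt).le (by positivity)
    nlinarith
  obtain ⟨N, g, hBN, hNB, hgpos, hgleN, hgM, hgN⟩ :=
    exists_parameters hpos hB36 hε hε1 hlog hη hM16
  rw [← hn, ← hM] at hgN
  -- The relation `r` stands for either direction. As `X` and `Y` may overlap, `Y` is cut to `g ≤ N`
  -- vertices and these are removed from `X`; the remaining `N` vertices contradict `hgN`.
  have hnot : ∀ X ⊆ U, ∀ Y ⊆ U, 2 * N ≤ #X → g ≤ #Y → T.TransOn Y → ∀ r : W → W → Prop,
      (∀ x y, x ≠ y → (¬ r x y → r y x)) → (r = T.Adj ∨ r = fun x y => T.Adj y x) →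
      ∃ x ∈ X, ∃ y ∈ Y, r x y := by
    intro X hX Y hY hXc hYc hYT r hr hr'
    by_contra hcon
    push Not at hcon
    obtain ⟨Y', hY', hY'c⟩ := exists_subset_card_eq hYc
    have h1 : ∀ x ∈ X \ Y', ∀ y ∈ Y', r y x := by
      intro x hx y hy
      obtain ⟨hx1, hx2⟩ := mem_sdiff.1 hx
      exact hr x y (fun e => hx2 (e ▸ hy)) (hcon x hx1 y (hY' hy))
    have h2 := hcomplete (X \ Y') (sdiff_subset.trans hX) Y' (hY'.trans hY)
      (card_pos.1 (by omega)) (hYT.mono hY') (by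
        rcases hr' with rfl | rfl
        · exact Or.inr h1
        · exact Or.inl h1)
    have h3 : N ≤ #(X \ Y') := by
      have := le_card_sdiff Y' X
      omega
    have h4 : (N : ℝ) ^ ε ≤ (#(X \ Y') : ℝ) ^ ε :=
      Real.rpow_le_rpow (by positivity) (by exact_mod_cast h3) hε.le
    rw [hY'c] at h2
    linarith
  refine hgal.not_isFree (U₀ := U) (N := N) (g := g) hh hL (hB8.trans hBN) hgpos ?_ ?_ ?_ hfree
  · intro Y hY hYc
    have h1 : N ≤ #Y := le_trans (Nat.le_mul_of_pos_left _ (by positivity)) hYc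
    -- Cutting down to exactly `N` vertices makes the set proper in `U`, so that minimality applies.
    obtain ⟨Y', hY', hY'c⟩ := exists_subset_card_eq h1
    have h2 : Y' ⊂ U := by
      refine (hY'.trans hY).ssubset_of_ne fun e => ?_
      rw [← e, hY'c] at hNB
      have h3 : 36 * N ≤ B * N := Nat.mul_le_mul_right _ hB36
      omega
    obtain ⟨S, hS, hST, hSc⟩ := hbig Y' h2
    rw [hY'c] at hSc
    exact ⟨S, hS.trans hY', hST, by exact_mod_cast hgM.trans hSc⟩
  · intro X hX Y hY hXc hYc hYT
    refine ⟨hnot X hX Y hY hXc hYc hYT T.Adj ?_ (Or.inl rfl),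
      hnot X hX Y hY hXc hYc hYT (fun x y => T.Adj y x) ?_ (Or.inr rfl)⟩
    · exact fun x y hxy h1 => (T.adj_or_adj hxy).resolve_left h1
    · exact fun x y hxy h1 => (T.adj_or_adj hxy).resolve_right h1
  · refine le_trans (le_of_eq ?_) hNB
    rw [hB]
    ring

/-! ### The explicit exponent -/

/-- Up to the factor 8h, `B` is an `L`-th power of a number h^O(h) with L = O(h). Numerical
constants are absorbed into powers of `h`, which is at least 2. -/
theorem log_size_bound {h L B : ℕ} (hh : 2 ≤ h) (hL : L = 2 * h + 1)
    (hB : B = 8 * h * (2 * (h * (8 * L ^ 2 * (8 * h ^ 2)) ^ h)) ^ L) :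
    Real.log (2 * B) ≤ 64 * h ^ 2 * Real.log h := by
  have hL3 : L ≤ 3 * h := by omega
  have hLh : L ≤ h ^ 3 := hL3.trans (by nlinarith)
  have h1 : 8 * L ^ 2 * (8 * h ^ 2) ≤ h ^ 14 := by
    calc 8 * L ^ 2 * (8 * h ^ 2) = 2 ^ 6 * L ^ 2 * h ^ 2 := by ring
      _ ≤ h ^ 6 * (h ^ 3) ^ 2 * h ^ 2 := by
          gcongr
      _ = h ^ 14 := by ring
  have h2 : 2 * (h * (8 * L ^ 2 * (8 * h ^ 2)) ^ h) ≤ h ^ (16 * h) := by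
    calc 2 * (h * (8 * L ^ 2 * (8 * h ^ 2)) ^ h) ≤ h * (h * (h ^ 14) ^ h) := by gcongr
      _ = h ^ (14 * h + 2) := by rw [← pow_mul]; ring
      _ ≤ h ^ (16 * h) := Nat.pow_le_pow_right (by omega) (by omega)
  have h3 : 2 * B ≤ h ^ (64 * h ^ 2) := by
    calc 2 * B = 2 ^ 4 * h * (2 * (h * (8 * L ^ 2 * (8 * h ^ 2)) ^ h)) ^ L := by rw [hB]; ring
      _ ≤ h ^ 4 * h * (h ^ (16 * h)) ^ L := by
          gcongr
      _ = h ^ (5 + 16 * h * L) := by rw [← pow_mul]; ring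
      _ ≤ h ^ (64 * h ^ 2) := Nat.pow_le_pow_right (by omega) (by nlinarith)
  have hBpos : 0 < B := by
    rw [hB]
    have : 0 < L := by omega
    positivity
  have h4 : (2 * B : ℝ) ≤ (h : ℝ) ^ (64 * h ^ 2) := by exact_mod_cast h3
  calc Real.log (2 * B) ≤ Real.log ((h : ℝ) ^ (64 * h ^ 2)) :=
        Real.log_le_log (by positivity) h4
    _ = _ := by rw [Real.log_pow]; push_cast; ring

end Combinatorics

end Tournament

theorem theorem1 :
    ∃ C : ℝ, 0 < C ∧
      ∀ (V : Type u) [Fintype V] (H : Tournament V),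
        2 ≤ Fintype.card V → H.IsPrime → H.IsGalaxy →
          ENNReal.ofReal (C / ((Fintype.card V : ℝ) ^ 5 * Real.log (Fintype.card V : ℝ)))
              ≤ H.ehCoefficient ∧
          ∀ (W : Type v) [Fintype W] (T : Tournament W), T.IsFree H →
            ∃ S : Finset W, (T.induce (S : Set W)).IsTransitive ∧
              (Fintype.card W : ℝ) ^
                (C / ((Fintype.card V : ℝ) ^ 5 * Real.log (Fintype.card V : ℝ))) ≤
                (S.card : ℝ) := by
  -- 4096 = 64 · 64: one factor is from the condition on ε in `IsGalaxy.exists_transOn`, the other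
  -- from `log_size_bound`.
  refine ⟨1 / 4096, by norm_num, fun V _ H hV _ hgal => ?_⟩
  have hne : Nonempty V := Fintype.card_pos_iff.1 (by omega)
  set h := Fintype.card V with hh
  have hV' : (2 : ℝ) ≤ h := by exact_mod_cast hV
  have hlog : 0 < Real.log h := Real.log_pos (by linarith)
  set ε : ℝ := 1 / 4096 / ((h : ℝ) ^ 5 * Real.log h) with hε
  have hεpos : 0 < ε := by positivity
  obtain ⟨L, hL⟩ : ∃ L, L = 2 * h + 1 := ⟨_, rfl⟩
  obtain ⟨B, hB⟩ : ∃ B, B = 8 * h * (2 * (h * (8 * L ^ 2 * (8 * h ^ 2)) ^ h)) ^ L := ⟨_, rfl⟩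
  have hεB : ε * (64 * h * Real.log (2 * B)) ≤ 1 := by
    have h1 := Tournament.log_size_bound hV hL hB
    have h2 : ε * (64 * h * Real.log (2 * B)) ≤ ε * (64 * h * (64 * h ^ 2 * Real.log h)) := by
      gcongr
    refine h2.trans ?_
    have h3 : ε * (4096 * ((h : ℝ) ^ 5 * Real.log h)) = 1 := by
      rw [hε]
      field_simp
    rw [← h3]
    refine mul_le_mul_of_nonneg_left ?_ hεpos.le
    have h4 : (h : ℝ) ^ 3 ≤ (h : ℝ) ^ 5 := pow_le_pow_right₀ (by linarith) (by norm_num)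
    calc 64 * (h : ℝ) * (64 * h ^ 2 * Real.log h) = 4096 * ((h : ℝ) ^ 3 * Real.log h) := by ring
      _ ≤ _ := by gcongr
  have key : ∀ {W : Type v} [Fintype W] (T : Tournament W), T.IsFree H →
      ∃ S : Finset W, (T.induce (S : Set W)).IsTransitive ∧
        (Fintype.card W : ℝ) ^ ε ≤ (S.card : ℝ) := by
    intro W _ T hT
    obtain ⟨S, hS, hSc⟩ := hgal.exists_transOn hT hh hL hB hεpos hεB
    exact ⟨S, hS.isTransitive, hSc⟩
  -- `Fin n` lives in the lowest universe, so `key`, which is tied to the universe `v`, does not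
  -- cover it.
  have key' : H.SatisfiesEHWith ε := by
    refine ⟨hεpos, fun n T hT => ?_⟩
    obtain ⟨S, hS, hSc⟩ := hgal.exists_transOn hT hh hL hB hεpos hεB
    exact ⟨S, hS.isTransitive, by simpa using hSc⟩
  exact ⟨le_iSup₂_of_le (f := fun (ε : ℝ) (_ : H.SatisfiesEHWith ε) => ENNReal.ofReal ε)
    ε key' le_rfl, fun W _ T hT => key T hT⟩
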